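/- Let $\mathbb D$ be the open unit disk and $H(\mathbb D)$ the space of analytic functions on $\mathbb D$. A radial weight is a positive continuous function $\nu$ on $\mathbb D$ with $\nu(z)=\nu(|z|)$ that is non-increasing in $|z|$. It is \emph{normal} if for some $\beta>0$ the function $r\mapsto \nu(r)/(1-r^2)^{\beta}$ is almost increasing on $[0,1)$, and for some $\gamma>0$ the function $r\mapsto\nu(r)/(1-r^2)^{\gamma}$ is almost decreasing on $[0,1)$; here $u\ge 0$ is almost increasing (almost decreasing) if there is $C>0$ with $u(r)\le C u(s)$ (respectively $u(s)\le C u(r)$) whenever $0\le r\le s<1$. Let $$\mathcal H^\infty_\nu=\Big\{f\in H(\mathbb D):\ \|f\|=\sup_{z\in\mathbb D}\nu(z)|f(z)|<\infty\Big\},\qquad \mathcal H^0_\nu=\Big\{f\in H(\mathbb D):\ \lim_{|z|\to1^-}\nu(z)|f(z)|=0\Big\}\subset\mathcal H^\infty_\nu ,$$ with $\mathcal H^0_\nu$ carrying the norm of $\mathcal H^\infty_\nu$. For $g\in H(\mathbb D)$ and an analytic map $\phi:\mathbb D\to\mathbb D$ put $$(T^\phi_g f)(z)=\int_0^z f(\phi(\zeta))\,g'(\zeta)\,d\zeta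 ,\qquad f\in H(\mathbb D),\ z\in\mathbb D .$$ Let $\nu,\mu$ be normal weights, $g\in H(\mathbb D)$ and $\phi:\mathbb D\to\mathbb D$ analytic, and suppose that $T^\phi_g:\mathcal H^0_\nu\to\mathcal H^\infty_\mu$ is bounded. Then, for $\kappa\in\{\nu,\mu\}$, the map $\Phi_\kappa$ that sends $F\in(\mathcal H^0_\kappa)''$ to the function $z\mapsto F(\delta_z)$, where $\delta_z\in(\mathcal H^0_\kappa)'$ is evaluation at $z$, is a linear homeomorphism of $(\mathcal H^0_\kappa)''$ onto $\mathcal H^\infty_\kappa$; also $T^\phi_g:\mathcal H^\infty_\nu\to\mathcal H^\infty_\mu$ is bounded; and the following hold. (i) The following are equivalent: (a) $T^\phi_g:\mathcal H^0_\nu\to\mathcal H^\infty_\mu$ is compact; (b) $T^\phi_g:\mathcal H^0_\nu\to\mathcal H^\infty_\mu$ is weakly compact; (c) the bi-transpose $(T^\phi_g)'':(\mathcal H^0_\nu)''\to(\mathcal H^\infty_\mu)''$ of $T^\phi_g:\mathcal H^0_\nu\to\mathcal H^\infty_\mu$ satisfies $(T^\phi_g)''=T^\phi_g$, that is, $(T^\phi_g)''F=J\,T^\phi_g(\Phi_\nu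 F)$ for all $F\in(\mathcal H^0_\nu)''$, where $J:\mathcal H^\infty_\mu\to(\mathcal H^\infty_\mu)''$ is the canonical embedding. (ii) If $\lim_{|z|\to1^-}(1-|z|^2)\mu(z)|g'(z)|=0$ (that is, $g$ belongs to the little weighted Bloch space $\mathcal B^0_{(1-|z|^2)\mu(z)}$), then $T^\phi_g$ maps $\mathcal H^0_\nu$ boundedly into $\mathcal H^0_\mu$, and the bi-transpose of $T^\phi_g:\mathcal H^0_\nu\to\mathcal H^0_\mu$ satisfies $(T^\phi_g)''=T^\phi_g$, that is, $\Phi_\mu\big((T^\phi_g)''F\big)=T^\phi_g(\Phi_\nu F)$ for all $F\in(\mathcal H^0_\nu)''$. Moreover, $T^\phi_g:\mathcal H^0_\nu\to\mathcal H^0_\mu$ is compact if and only if $T^\phi_g(\mathcal H^\infty_\nu)\subset\mathcal H^0_\mu$. -/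

import Mathlib

open Filter Topology

noncomputable section

namespace VolterraComp

/-- The open unit disk of `ℂ`. -/
abbrev disk : Set ℂ := Metric.ball (0 : ℂ) 1

/-- The filter `|z| → 1⁻`. -/
def toBoundary : Filter ℂ := comap (fun z : ℂ => ‖z‖) (𝓝[<] (1 : ℝ))

/-- A radial weight on the unit disk: a positive continuous function of `|z|` that is
non-increasing in `|z|`. Values off the disk are never used. -/
structure RadialWeight where
  toFun : ℂ → ℝ
  continuousOn : ContinuousOn toFun disk
  pos : ∀ z ∈ disk, 0 < toFun z
  radial : ∀ z ∈ disk, toFun z = toFun ((‖z‖ : ℝ) : ℂ)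
  antitone : AntitoneOn (fun r : ℝ => toFun (r : ℂ)) (Set.Ico 0 1)

instance : CoeFun RadialWeight (fun _ => ℂ → ℝ) := ⟨RadialWeight.toFun⟩

/-- `u` is almost increasing on `[0, 1)`. -/
def AlmostIncreasing (u : ℝ → ℝ) : Prop :=
  ∃ C : ℝ, 0 < C ∧ ∀ r ∈ Set.Ico (0 : ℝ) 1, ∀ s ∈ Set.Ico (0 : ℝ) 1, r ≤ s → u r ≤ C * u s

/-- `u` is almost decreasing on `[0, 1)`. -/
def AlmostDecreasing (u : ℝ → ℝ) : Prop :=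
  ∃ C : ℝ, 0 < C ∧ ∀ r ∈ Set.Ico (0 : ℝ) 1, ∀ s ∈ Set.Ico (0 : ℝ) 1, r ≤ s → u s ≤ C * u r

/-- Normal weights in the sense of Shields and Williams. -/
structure RadialWeight.IsNormal (ν : RadialWeight) : Prop where
  almostIncreasing : ∃ β : ℝ, 0 < β ∧
    AlmostIncreasing (fun r : ℝ => ν (r : ℂ) / (1 - r ^ 2) ^ β)
  almostDecreasing : ∃ γ : ℝ, 0 < γ ∧
    AlmostDecreasing (fun r : ℝ => ν (r : ℂ) / (1 - r ^ 2) ^ γ)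

/-- `H(𝔻)`: a holomorphic function on the disk is represented by its extension by zero to `ℂ`,
so that functions agreeing on the disk are equal. -/
def Hol : Submodule ℂ (ℂ → ℂ) where
  carrier := {f | DifferentiableOn ℂ f disk ∧ ∀ z ∉ disk, f z = 0}
  add_mem' := fun hf hg => ⟨hf.1.add hg.1, fun z hz => by
    simp [hf.2 z hz, hg.2 z hz]⟩
  zero_mem' := ⟨differentiableOn_const 0, fun _ _ => rfl⟩
  smul_mem' := fun c _ hf => ⟨hf.1.const_smul c, fun z hz => by simp [hf.2 z hz]⟩

/-- The functions `f` in `H(𝔻)` with `sup ν |f| < ∞`, as a submodule. -/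
def hInfSubmodule (ν : RadialWeight) : Submodule ℂ (ℂ → ℂ) where
  carrier := {f | f ∈ Hol ∧ BddAbove (Set.range fun z : disk => ν z * ‖f z‖)}
  add_mem' := by
    rintro f g ⟨hf, a, ha⟩ ⟨hg, b, hb⟩
    refine ⟨Hol.add_mem hf hg, a + b, ?_⟩
    rintro _ ⟨z, rfl⟩
    have h1 := ha ⟨z, rfl⟩
    have h2 := hb ⟨z, rfl⟩
    have h3 := mul_le_mul_of_nonneg_left (norm_add_le (f z) (g z)) (ν.pos z z.2).le
    simp only [Pi.add_apply] at *
    linarith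
  zero_mem' := ⟨Hol.zero_mem, 0, by rintro _ ⟨z, rfl⟩; simp⟩
  smul_mem' := by
    rintro c f ⟨hf, a, ha⟩
    refine ⟨Hol.smul_mem c hf, ‖c‖ * a, ?_⟩
    rintro _ ⟨z, rfl⟩
    have h1 := mul_le_mul_of_nonneg_left (ha ⟨z, rfl⟩) (norm_nonneg c)
    simp only [Pi.smul_apply, norm_smul] at *
    linarith

/-- The weighted Banach space `H^∞_ν`. It is a type synonym of the submodule above, so that it
carries the weighted sup norm and not the topology of pointwise convergence. -/
def HInf (ν : RadialWeight) : Type := hInfSubmodule ν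

namespace HInf

variable {ν : RadialWeight}

instance : AddCommGroup (HInf ν) := inferInstanceAs (AddCommGroup (hInfSubmodule ν))

instance : Module ℂ (HInf ν) := inferInstanceAs (Module ℂ (hInfSubmodule ν))

instance : CoeFun (HInf ν) (fun _ => ℂ → ℂ) := ⟨fun f => (Subtype.val f : ℂ → ℂ)⟩

/-- `‖f‖ = sup_{|z| < 1} ν(z) |f(z)|`. -/
instance : Norm (HInf ν) := ⟨fun f => ⨆ z : disk, ν z * ‖f z‖⟩

theorem norm_def (f : HInf ν) : ‖f‖ = ⨆ z : disk, ν z * ‖f z‖ := rfl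

theorem weight_mul_le_norm (f : HInf ν) {z : ℂ} (hz : z ∈ disk) : ν z * ‖f z‖ ≤ ‖f‖ :=
  le_ciSup (f := fun z : disk => ν z * ‖f z‖) f.2.2 ⟨z, hz⟩

theorem norm_le {f : HInf ν} {M : ℝ} (h : ∀ z ∈ disk, ν z * ‖f z‖ ≤ M) : ‖f‖ ≤ M :=
  haveI : Nonempty disk := ⟨⟨0, by simp⟩⟩
  ciSup_le fun z => h z z.2

theorem add_apply (f g : HInf ν) (z : ℂ) : (f + g) z = f z + g z := rfl

theorem smul_apply (c : ℂ) (f : HInf ν) (z : ℂ) : (c • f) z = c * f z := rfl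

theorem zero_apply (z : ℂ) : (0 : HInf ν) z = 0 := rfl

theorem apply_eq_zero (f : HInf ν) {z : ℂ} (hz : z ∉ disk) : f z = 0 := f.2.1.2 z hz

theorem normCore : NormedSpace.Core ℂ (HInf ν) where
  norm_nonneg f := Real.iSup_nonneg fun z => mul_nonneg (ν.pos z z.2).le (norm_nonneg _)
  norm_smul c f := by
    rw [norm_def, norm_def, Real.mul_iSup_of_nonneg (norm_nonneg c)]
    refine iSup_congr fun z => ?_
    rw [smul_apply, norm_mul]
    ring
  norm_triangle f g := by
    refine norm_le fun z hz => ?_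
    have h1 := weight_mul_le_norm f hz
    have h2 := weight_mul_le_norm g hz
    have h3 := mul_le_mul_of_nonneg_left (norm_add_le (f z) (g z)) (ν.pos z hz).le
    rw [add_apply]
    linarith
  norm_eq_zero_iff f := by
    constructor
    · intro h
      apply Subtype.ext
      funext z
      by_cases hz : z ∈ disk
      · have h1 := weight_mul_le_norm f hz
        rw [h] at h1
        have h2 : ‖f z‖ ≤ 0 := nonpos_of_mul_nonpos_right h1 (ν.pos z hz)
        exact norm_le_zero_iff.mp h2
      · exact apply_eq_zero f hz
    · rintro rfl
      rw [norm_def]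
      simp [zero_apply]

instance : NormedAddCommGroup (HInf ν) := NormedAddCommGroup.ofCore normCore

instance : NormedSpace ℂ (HInf ν) := NormedSpace.ofCore normCore

/-- Point evaluation on `H^∞_ν` as a continuous linear functional. -/
def evalCLM (ν : RadialWeight) (z : ℂ) : HInf ν →L[ℂ] ℂ :=
  LinearMap.mkContinuous
    { toFun := fun f => f z
      map_add' := fun _ _ => rfl
      map_smul' := fun _ _ => rfl } |(ν z)⁻¹| (by
    intro f
    show ‖f z‖ ≤ |(ν z)⁻¹| * ‖f‖
    by_cases hz : z ∈ disk
    · have hp := ν.pos z hz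
      rw [abs_of_pos (inv_pos.mpr hp), le_inv_mul_iff₀ hp]
      exact weight_mul_le_norm f hz
    · rw [apply_eq_zero f hz, norm_zero]
      positivity)

end HInf

/-- A holomorphic function with `ν |f| → 0` at the boundary belongs to `H^∞_ν`, so defining
`H^0_ν` inside `H^∞_ν` loses nothing. -/
theorem mem_hInfSubmodule_of_tendsto {ν : RadialWeight} {f : ℂ → ℂ} (hf : f ∈ Hol)
    (h : Tendsto (fun z : ℂ => ν z * ‖f z‖) toBoundary (𝓝 0)) : f ∈ hInfSubmodule ν := by
  refine ⟨hf, ?_⟩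
  obtain ⟨t, ht, hts⟩ := mem_comap.mp (h.eventually (gt_mem_nhds one_pos))
  obtain ⟨r, hr, hrt⟩ := (mem_nhdsLT_iff_exists_Ioo_subset (a := (1 : ℝ))).mp ht
  have hsub : Metric.closedBall (0 : ℂ) r ⊆ disk := Metric.closedBall_subset_ball hr
  obtain ⟨M, hM⟩ := (isCompact_closedBall (0 : ℂ) r).bddAbove_image
    ((ν.continuousOn.mul hf.1.continuousOn.norm).mono hsub)
  refine ⟨max M 1, ?_⟩
  rintro _ ⟨z, rfl⟩
  by_cases hz : ‖(z : ℂ)‖ ≤ r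
  · exact le_max_of_le_left (hM ⟨z, by simpa using hz, rfl⟩)
  · have hz1 : ‖(z : ℂ)‖ < 1 := mem_ball_zero_iff.mp z.2
    exact le_max_of_le_right (le_of_lt (hts (hrt ⟨not_le.mp hz, hz1⟩)))

/-- `H^0_ν` as a subspace of `H^∞_ν`, with the norm of `H^∞_ν`. -/
def HZero (ν : RadialWeight) : Submodule ℂ (HInf ν) where
  carrier := {f | Tendsto (fun z : ℂ => ν z * ‖f z‖) toBoundary (𝓝 0)}
  zero_mem' := by
    simpa [HInf.zero_apply] using tendsto_const_nhds
  add_mem' := by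
    intro f g hf hg
    have hev : ∀ᶠ z : ℂ in toBoundary, z ∈ disk :=
      (eventually_mem_nhdsWithin.comap _).mono fun z hz => by simpa using hz
    have hfg := hf.add hg
    rw [add_zero] at hfg
    refine squeeze_zero' (hev.mono fun z hz => ?_) (hev.mono fun z hz => ?_) hfg
    · exact mul_nonneg (ν.pos z hz).le (norm_nonneg _)
    · rw [HInf.add_apply, ← mul_add]
      exact mul_le_mul_of_nonneg_left (norm_add_le _ _) (ν.pos z hz).le
  smul_mem' := by
    intro c f hf
    have h := hf.const_mul ‖c‖
    rw [mul_zero] at h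
    refine h.congr fun z => ?_
    rw [HInf.smul_apply, norm_mul]
    ring

/-- Point evaluation `δ_z` as an element of the dual of `H^0_ν`. -/
def delta (ν : RadialWeight) (z : ℂ) : StrongDual ℂ (HZero ν) :=
  (HInf.evalCLM ν z).comp (HZero ν).subtypeL

/-- The little weighted Bloch space `B^0_w`: `g` is holomorphic on the disk and
`w(z) |g'(z)| → 0` as `|z| → 1⁻`. -/
def MemLittleBloch (w : ℂ → ℝ) (g : ℂ → ℂ) : Prop :=
  DifferentiableOn ℂ g disk ∧ Tendsto (fun z : ℂ => w z * ‖deriv g z‖) toBoundary (𝓝 0)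

/-- `(T_g^φ f)(z) = ∫_0^z f(φ(ζ)) g'(ζ) dζ`, the integral along the segment from `0` to `z`. -/
def volterra (g φ f : ℂ → ℂ) (z : ℂ) : ℂ :=
  ∫ t in (0 : ℝ)..1, f (φ ((t : ℂ) * z)) * deriv g ((t : ℂ) * z) * z

section Operators

variable {X Y : Type} [NormedAddCommGroup X] [NormedSpace ℂ X]
  [NormedAddCommGroup Y] [NormedSpace ℂ Y]

/-- The bidual Banach space. -/
abbrev Bidual (X : Type) [NormedAddCommGroup X] [NormedSpace ℂ X] : Type :=
  StrongDual ℂ (StrongDual ℂ X)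

/-- The transpose `T' : Y' → X'`, `T' y' = y' ∘ T`. -/
def transpose (T : X →L[ℂ] Y) : StrongDual ℂ Y →L[ℂ] StrongDual ℂ X := T.precomp ℂ

/-- The bi-transpose `T'' : X'' → Y''`. -/
def bitranspose (T : X →L[ℂ] Y) : Bidual X →L[ℂ] Bidual Y := transpose (transpose T)

/-- Weakly compact operators: the image of the closed unit ball is relatively weakly compact. -/
def IsWeaklyCompactOp (T : X →L[ℂ] Y) : Prop :=
  IsCompact (closure (toWeakSpace ℂ Y '' (T '' Metric.closedBall (0 : X) 1)))

end Operators

/-- `Φ` is the canonical identification of the bidual of `H^0_ν` with `H^∞_ν`, under which `F`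
in the bidual corresponds to the function `z ↦ F(δ_z)`. -/
def IsCanonical (ν : RadialWeight) (Φ : Bidual (HZero ν) ≃L[ℂ] HInf ν) : Prop :=
  ∀ F : Bidual (HZero ν), ∀ z ∈ disk, Φ F z = F (delta ν z)

end VolterraComp

end

/-! The proof rests on dilations and gliding humps. The dilations `z ↦ f (rad n * z)` of `f` in
`H^∞_ν` lie in `H^0_ν`, have norm at most `‖f‖` and converge pointwise to `f`; a weak-star cluster
point of them in the bidual is a preimage of `f` under `Φ`. Injectivity of `Φ` is the density of
point evaluations in the dual (`exists_mem_span_eval`). It follows from the fact that a functional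
is small on bounded functions that are small on a large smaller disk: otherwise gliding humps give a
subsequence whose weighted moduli have bounded sums, on which a functional must be summable. By
density, dilations converge weak-star, and dominated convergence in the integral identifies the
bi-transpose with the Volterra operator at point evaluations. A weakly compact `T` has a
bi-transpose with range in `Y`. Conversely such a `T` is compact
(`isCompactOperator_of_bitranspose`): if it were not small on humps, the sums of the subseries over
all `A ⊆ ℕ` would be mapped to a uniformly separated uncountable family in a separable subspace of
`Y`. For (ii), the little Bloch condition sends bounded functions into `H^0_μ`; dilations are
bounded and converge weakly, and the norm-closed subspace `H^0_μ` is weakly closed. -/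

noncomputable section

namespace VolterraComp

/-! ### Weak-star limits, separation and separability. -/

section Duality

variable {E : Type*} [NormedAddCommGroup E] [NormedSpace ℂ E]

/-- Banach–Alaoglu along an ultrafilter. -/
theorem exists_weakStar_limit {ι : Type*} (U : Ultrafilter ι) (u : ι → StrongDual ℂ E) {R : ℝ}
    (hu : ∀ i, ‖u i‖ ≤ R) :
    ∃ L : StrongDual ℂ E, ‖L‖ ≤ R ∧ ∀ x, Tendsto (fun i => u i x) U (𝓝 (L x)) := by
  have hK := WeakDual.isCompact_closedBall (𝕜 := ℂ) (0 : StrongDual ℂ E) R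
  obtain ⟨L, hL, hle⟩ := isCompact_iff_ultrafilter_le_nhds.mp hK
    (U.map fun i => StrongDual.toWeakDual (u i)) (by
      rw [le_principal_iff, Ultrafilter.coe_map, mem_map]
      refine univ_mem' fun i => ?_
      simpa using hu i)
  refine ⟨WeakDual.toStrongDual L, by simpa using hL, fun x => ?_⟩
  exact ((WeakDual.eval_continuous (𝕜 := ℂ) x).tendsto L).comp hle

/-- A vector on which all functionals annihilating a closed subspace vanish lies in it. -/
theorem mem_of_forall_dual_eq_zero (p : Submodule ℂ E) (hp : IsClosed (p : Set E)) {x : E}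
    (h : ∀ y' : StrongDual ℂ E, (∀ v ∈ p, y' v = 0) → y' x = 0) : x ∈ p := by
  by_contra hx
  have hne : (Submodule.Quotient.mk x : E ⧸ p) ≠ 0 := by
    rwa [Ne, Submodule.Quotient.mk_eq_zero]
  -- Closedness makes the quotient a normed space, so its dual separates points.
  have : IsClosed (p.toAddSubgroup : Set E) := hp
  obtain ⟨f, hf⟩ := SeparatingDual.exists_ne_zero (R := ℂ) hne
  refine hf (h (f.comp p.mkQL) fun v hv => ?_)
  have : (Submodule.Quotient.mk v : E ⧸ p) = 0 := (Submodule.Quotient.mk_eq_zero p).mpr hv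
  show f (Submodule.Quotient.mk v) = 0
  rw [this, map_zero]

/-- Separability of closed spans of sequences forbids a uniformly separated family in such a span
that is indexed by the subsets of `ℕ`. -/
theorem not_separated_of_mem_closure_span (u : ℕ → E) (y : Set ℕ → E) {c : ℝ} (hc : 0 < c)
    (hy : ∀ A, y A ∈ (Submodule.span ℂ (Set.range u)).topologicalClosure)
    (hsep : ∀ A B, A ≠ B → c ≤ ‖y A - y B‖) : False := by
  have hs : TopologicalSpace.IsSeparable
      ((Submodule.span ℂ (Set.range u)).topologicalClosure : Set E) := by
    rw [Submodule.topologicalClosure_coe]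
    exact ((Set.countable_range u).isSeparable.span (R := ℂ)).closure
  obtain ⟨D, hD, hsub⟩ := hs
  have hnear : ∀ A, ∃ d ∈ D, dist (y A) d < c / 2 := fun A =>
    Metric.mem_closure_iff.mp (hsub (hy A)) _ (by positivity)
  choose d hdD hd using hnear
  obtain ⟨e, he⟩ := Set.countable_iff_exists_injOn.mp hD
  -- Two sets sharing a nearby point of `D` have vectors at distance less than `c`, so coding that
  -- point would embed `Set ℕ` in `ℕ`.
  refine Function.cantor_injective (fun A => e (d A)) fun A B hAB => ?_
  by_contra hne
  have h1 : d A = d B := he (hdD A) (hdD B) hAB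
  have h2 := hsep A B hne
  have h3 := dist_triangle_right (y A) (y B) (d A)
  have h4 := hd A
  have h5 := hd B
  rw [← h1] at h5
  rw [← dist_eq_norm] at h2
  linarith

theorem completeSpace_of_equiv {G : Type*} [NormedAddCommGroup G] [NormedSpace ℂ G]
    [CompleteSpace E] (e : E ≃L[ℂ] G) : CompleteSpace G :=
  (e.isUniformEmbedding.isUniformInducing.completeSpace_congr e.surjective).mp inferInstance

end Duality

/-! ### Normal weights and regularity of point evaluations. -/

section WeightedSpaces

theorem mem_disk {z : ℂ} : z ∈ disk ↔ ‖z‖ < 1 := mem_ball_zero_iff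

theorem eventually_toBoundary_iff {P : ℂ → Prop} :
    (∀ᶠ z in toBoundary, P z) ↔ ∃ r : ℝ, r < 1 ∧ ∀ z, r < ‖z‖ → ‖z‖ < 1 → P z := by
  constructor
  · intro h
    obtain ⟨t, ht, hts⟩ := mem_comap.mp h
    obtain ⟨r, hr, hrt⟩ := (mem_nhdsLT_iff_exists_Ioo_subset (a := (1 : ℝ))).mp ht
    exact ⟨r, hr, fun z h1 h2 => hts (hrt ⟨h1, h2⟩)⟩
  · rintro ⟨r, hr, h⟩
    exact mem_comap.mpr ⟨Set.Ioo r 1, Ioo_mem_nhdsLT hr, fun z hz => h z hz.1 hz.2⟩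

theorem eventually_mem_disk : ∀ᶠ z in toBoundary, z ∈ disk :=
  eventually_toBoundary_iff.mpr ⟨0, one_pos, fun _ _ h => mem_disk.mpr h⟩

theorem tendsto_weight_mul_norm_iff {ν : RadialWeight} {f : ℂ → ℂ} :
    Tendsto (fun z => ν z * ‖f z‖) toBoundary (𝓝 0) ↔
      ∀ ε > 0, ∃ r : ℝ, r < 1 ∧ ∀ z, r < ‖z‖ → ‖z‖ < 1 → ν z * ‖f z‖ < ε := by
  rw [Metric.tendsto_nhds]
  refine forall₂_congr fun ε _ => ?_
  rw [eventually_toBoundary_iff]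
  refine exists_congr fun r => and_congr_right fun _ => forall₃_congr fun z _ hz => ?_
  rw [dist_zero_right, Real.norm_of_nonneg
    (mul_nonneg (ν.pos z (mem_disk.mpr hz)).le (norm_nonneg _))]

namespace RadialWeight

variable {ν : RadialWeight}

theorem le_of_norm_le {z w : ℂ} (hw : w ∈ disk) (h : ‖z‖ ≤ ‖w‖) : ν w ≤ ν z := by
  have hw1 := mem_disk.mp hw
  rw [ν.radial z (mem_disk.mpr (h.trans_lt hw1)), ν.radial w hw]
  exact ν.antitone ⟨norm_nonneg z, h.trans_lt hw1⟩ ⟨norm_nonneg w, hw1⟩ h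

theorem IsNormal.exists_le_mul_rpow (hν : ν.IsNormal) : ∃ γ : ℝ, 0 < γ ∧ ∃ C : ℝ, 0 < C ∧
    ∀ z ∈ disk, ∀ w, ‖w‖ ≤ ‖z‖ →
      ν z ≤ C * ν w * ((1 - ‖z‖ ^ 2) ^ γ / (1 - ‖w‖ ^ 2) ^ γ) := by
  obtain ⟨γ, hγ, C, hC, h⟩ := hν.almostDecreasing
  refine ⟨γ, hγ, C, hC, fun z hz w hwz => ?_⟩
  have hz1 := mem_disk.mp hz
  have hw1 := hwz.trans_lt hz1
  have key := h _ ⟨norm_nonneg w, hw1⟩ _ ⟨norm_nonneg z, hz1⟩ hwz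
  simp only [← ν.radial z hz, ← ν.radial w (mem_disk.mpr hw1)] at key
  have hpz : 0 < (1 - ‖z‖ ^ 2) ^ γ :=
    Real.rpow_pos_of_pos (by nlinarith [norm_nonneg z]) _
  rw [div_le_iff₀ hpz] at key
  refine key.trans (le_of_eq ?_)
  ring

/-- Compare with the origin. This is what places bounded functions, in particular dilations, in
`H^0_ν`. -/
theorem IsNormal.tendsto_zero (hν : ν.IsNormal) : Tendsto ν toBoundary (𝓝 0) := by
  obtain ⟨γ, hγ, C, _, h⟩ := hν.exists_le_mul_rpow
  have h1 : Tendsto (fun z : ℂ => ‖z‖) toBoundary (𝓝 1) :=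
    (tendsto_comap (f := fun z : ℂ => ‖z‖)).mono_right nhdsWithin_le_nhds
  have h2 : Tendsto (fun z : ℂ => C * ν 0 * (1 - ‖z‖ ^ 2) ^ γ) toBoundary (𝓝 0) := by
    have h3 : Tendsto (fun z : ℂ => 1 - ‖z‖ ^ 2) toBoundary (𝓝 0) := by
      simpa using (h1.pow 2).const_sub 1
    have h4 := (h3.rpow_const (p := γ) (Or.inr hγ.le)).const_mul (C * ν 0)
    simpa [Real.zero_rpow hγ.ne'] using h4
  refine squeeze_zero' (eventually_mem_disk.mono fun z hz => (ν.pos z hz).le)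
    (eventually_mem_disk.mono fun z hz => ?_) h2
  simpa using h z hz 0 (by simp)

end RadialWeight

variable {ν : RadialWeight}

theorem HInf.norm_apply_le (f : HInf ν) {z : ℂ} (hz : z ∈ disk) : ‖f z‖ ≤ ‖f‖ / ν z := by
  rw [le_div_iff₀' (ν.pos z hz)]
  exact f.weight_mul_le_norm hz

theorem HInf.sub_apply (f g : HInf ν) (z : ℂ) : (f - g) z = f z - g z := rfl

theorem HInf.ext {f g : HInf ν} (h : ∀ z ∈ disk, f z = g z) : f = g := by
  apply Subtype.ext
  funext z
  by_cases hz : z ∈ disk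
  · exact h z hz
  · rw [f.apply_eq_zero hz, g.apply_eq_zero hz]

theorem HInf.differentiableOn (f : HInf ν) : DifferentiableOn ℂ f disk := f.2.1.1

/-- A normed space `X` with a linear isometry onto `H^0_ν`. -/
structure HZeroModel (ν : RadialWeight) (X : Type) [NormedAddCommGroup X] [NormedSpace ℂ X] where
  /-- The embedding of `X` into `H^∞_ν`. -/
  incl : X →ₗᵢ[ℂ] HInf ν
  incl_mem : ∀ f, incl f ∈ HZero ν
  exists_incl_eq : ∀ f ∈ HZero ν, ∃ x, incl x = f

namespace HZeroModel

variable {X : Type} [NormedAddCommGroup X] [NormedSpace ℂ X] (M : HZeroModel ν X)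

/-- Point evaluation on `X`. -/
def eval (z : ℂ) : StrongDual ℂ X := (HInf.evalCLM ν z).comp M.incl.toContinuousLinearMap

theorem eval_apply (z : ℂ) (f : X) : M.eval z f = M.incl f z := rfl

theorem weight_mul_le_norm (f : X) {z : ℂ} (hz : z ∈ disk) : ν z * ‖M.incl f z‖ ≤ ‖f‖ := by
  rw [← M.incl.norm_map f]
  exact (M.incl f).weight_mul_le_norm hz

theorem norm_apply_le (f : X) {z : ℂ} (hz : z ∈ disk) : ‖M.incl f z‖ ≤ ‖f‖ / ν z := by
  rw [← M.incl.norm_map f]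
  exact (M.incl f).norm_apply_le hz

theorem weight_mul_norm_eval_le {z : ℂ} (hz : z ∈ disk) : ν z * ‖M.eval z‖ ≤ 1 := by
  have hp := ν.pos z hz
  rw [← le_div_iff₀' hp]
  refine ContinuousLinearMap.opNorm_le_bound _ (by positivity) fun f => ?_
  rw [eval_apply, one_div, inv_mul_eq_div]
  exact M.norm_apply_le f hz

/-- Schwarz lemma on a disk reaching halfway to the boundary. There `ν` is at least `ν ρ`, so the
bound on `f` depends only on `‖f‖`. -/
theorem norm_eval_sub_le {z₀ : ℂ} (hz₀ : z₀ ∈ disk) : ∃ K s : ℝ, 0 < s ∧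
    ∀ z ∈ Metric.ball z₀ s, ‖M.eval z - M.eval z₀‖ ≤ K * dist z z₀ := by
  have h0 := mem_disk.mp hz₀
  have hn := norm_nonneg z₀
  set s := (1 - ‖z₀‖) / 2 with hs
  have hs0 : 0 < s := by rw [hs]; linarith
  set ρ : ℂ := (((1 + ‖z₀‖) / 2 : ℝ) : ℂ) with hρ
  have hρn : ‖ρ‖ = (1 + ‖z₀‖) / 2 := by
    rw [hρ, Complex.norm_real, Real.norm_of_nonneg (by positivity)]
  have hρd : ρ ∈ disk := mem_disk.mpr (by rw [hρn]; linarith)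
  have hp := ν.pos ρ hρd
  have hball : ∀ w ∈ Metric.ball z₀ s, ‖w‖ ≤ ‖ρ‖ := by
    intro w hw
    have h1 : ‖w - z₀‖ < s := by simpa [dist_eq_norm] using hw
    have h2 := norm_le_norm_add_norm_sub' w z₀
    rw [hρn]
    linarith
  have hdisk : ∀ w ∈ Metric.ball z₀ s, w ∈ disk := fun w hw =>
    mem_disk.mpr ((hball w hw).trans_lt (mem_disk.mp hρd))
  refine ⟨2 / ν ρ / s, s, hs0, fun z hz => ?_⟩
  refine ContinuousLinearMap.opNorm_le_bound _ (by positivity) fun f => ?_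
  have hb : ∀ w ∈ Metric.ball z₀ s, ‖M.incl f w‖ ≤ ‖f‖ / ν ρ := fun w hw =>
    (M.norm_apply_le f (hdisk w hw)).trans
      (div_le_div_of_nonneg_left (norm_nonneg _) hp (RadialWeight.le_of_norm_le hρd (hball w hw)))
  have key := Complex.dist_le_div_mul_dist_of_mapsTo_ball (f := fun w => M.incl f w)
    (c := z₀) (z := z) (R₁ := s) (R₂ := 2 * (‖f‖ / ν ρ)) ((M.incl f).differentiableOn.mono hdisk)
    (fun w hw => by
      rw [Metric.mem_closedBall, dist_eq_norm]
      have h1 := norm_sub_le (M.incl f w) (M.incl f z₀)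
      have h2 := hb w hw
      have h3 := hb z₀ (Metric.mem_ball_self hs0)
      linarith) hz
  rw [dist_eq_norm (M.incl f z)] at key
  refine key.trans (le_of_eq ?_)
  ring

theorem continuousOn_eval : ContinuousOn (M.eval) disk := by
  intro z₀ hz₀
  apply ContinuousAt.continuousWithinAt
  obtain ⟨K, s, hs, h⟩ := M.norm_eval_sub_le hz₀
  rw [ContinuousAt, tendsto_iff_norm_sub_tendsto_zero]
  have h1 : Tendsto (fun z => K * dist z z₀) (𝓝 z₀) (𝓝 0) := by
    have : Continuous fun z => K * dist z z₀ := by fun_prop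
    simpa using this.tendsto z₀
  exact squeeze_zero' (Eventually.of_forall fun _ => norm_nonneg _)
    (Filter.mem_of_superset (Metric.ball_mem_nhds z₀ hs) fun z hz => h z hz) h1

/-- Norm continuity gives meaning to the Cauchy integral of the evaluations; the scalar Cauchy
formula, tested on each `f`, shows that it reproduces them. This makes `z ↦ F (δ_z)` holomorphic for
every `F` in the bidual. -/
theorem differentiableOn_eval : DifferentiableOn ℂ (M.eval) disk := by
  intro z₀ hz₀
  have h0 := mem_disk.mp hz₀
  have hn := norm_nonneg z₀
  set ρ : NNReal := ⟨(1 + ‖z₀‖) / 2, by positivity⟩ with hρ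
  have hρ' : (ρ : ℝ) = (1 + ‖z₀‖) / 2 := rfl
  have hρ0 : 0 < ρ := by rw [← NNReal.coe_pos, hρ']; positivity
  have hsub : Metric.closedBall (0 : ℂ) ρ ⊆ disk :=
    Metric.closedBall_subset_ball (by rw [hρ']; linarith)
  have hcont : ContinuousOn (M.eval) (Metric.sphere (0 : ℂ) ρ) :=
    M.continuousOn_eval.mono (Metric.sphere_subset_closedBall.trans hsub)
  have hci : CircleIntegrable (M.eval) 0 ρ := hcont.circleIntegrable ρ.2
  have hps := hasFPowerSeriesOn_cauchy_integral hci hρ0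
  have hmem : Metric.ball (0 : ℂ) ρ ∈ 𝓝 z₀ :=
    Metric.isOpen_ball.mem_nhds (by rw [mem_ball_zero_iff, hρ']; linarith)
  have heq : Set.EqOn (M.eval) (fun w => (2 * Real.pi * Complex.I : ℂ)⁻¹ •
      ∮ z in C(0, ρ), (z - w)⁻¹ • M.eval z) (Metric.ball (0 : ℂ) ρ) := by
    intro w hw
    ext f
    have hf : DiffContOnCl ℂ (M.incl f) (Metric.ball 0 ρ) :=
      DifferentiableOn.diffContOnCl ((M.incl f).differentiableOn.mono
        (Metric.closure_ball_subset_closedBall.trans hsub))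
    have h1 := hf.circleIntegral_sub_inv_smul hw
    have hci' : CircleIntegrable (fun z => (z - w)⁻¹ • M.eval z) 0 ρ := by
      refine ContinuousOn.circleIntegrable ρ.2 (ContinuousOn.smul (ContinuousOn.inv₀
        (f := fun z => z - w) (by fun_prop) fun z hz => ?_) hcont)
      rw [sub_ne_zero]
      rintro rfl
      simp only [mem_sphere_iff_norm, sub_zero, mem_ball_zero_iff] at hz hw
      linarith
    have h2 : (∮ z in C(0, ρ), (z - w)⁻¹ • M.eval z) f =
        ∮ z in C(0, ρ), (z - w)⁻¹ • M.incl f z := by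
      rw [circleIntegral, circleIntegral,
        ContinuousLinearMap.intervalIntegral_apply hci'.out]
      rfl
    simp only [smul_apply, h2, h1, eval_apply]
    rw [smul_smul, inv_mul_cancel₀ (by simp [Real.pi_ne_zero]), one_smul]
  have hd : DifferentiableAt ℂ (fun w => (2 * Real.pi * Complex.I : ℂ)⁻¹ •
      ∮ z in C(0, ρ), (z - w)⁻¹ • M.eval z) z₀ := by
    refine (hps.analyticAt_of_mem ?_).differentiableAt
    rw [mem_eball_zero_iff]
    rw [enorm_eq_nnnorm, ENNReal.coe_lt_coe, ← NNReal.coe_lt_coe, coe_nnnorm, hρ']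
    linarith
  exact (hd.congr_of_eventuallyEq (heq.eventuallyEq_of_mem hmem)).differentiableWithinAt

/-- On bounded sets of `H^0_ν`, smallness at suitable finitely many points forces weighted
smallness on a given smaller disk. -/
theorem exists_finite_forall_small (R : ℝ) {r : ℝ} (hr : r < 1) {η : ℝ} (hη : 0 < η) :
    ∃ Z : Set ℂ, Z.Finite ∧ Z ⊆ disk ∧ ∃ d > 0, ∀ f : X, ‖f‖ ≤ R →
      (∀ z ∈ Z, ‖M.incl f z‖ ≤ d) → ∀ z, ‖z‖ ≤ r → ν z * ‖M.incl f z‖ ≤ η := by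
  have h00 : (0 : ℂ) ∈ disk := by simp
  have hν0 := ν.pos 0 h00
  -- Since `ν ≤ ν 0`, values up to `η / ν 0` are allowed: half for the values on the net, half for
  -- the oscillation around it.
  set d := η / ν 0 / 2 with hd
  have hd0 : 0 < d := by positivity
  have hsub : Metric.closedBall (0 : ℂ) r ⊆ disk := Metric.closedBall_subset_ball hr
  have hV : ∀ z₀ ∈ Metric.closedBall (0 : ℂ) r,
      {z | ‖M.eval z - M.eval z₀‖ * (|R| + 1) < d} ∈ 𝓝 z₀ := by
    intro z₀ hz₀
    have hc : ContinuousAt (M.eval) z₀ :=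
      M.continuousOn_eval.continuousAt (Metric.isOpen_ball.mem_nhds (hsub hz₀))
    have hc2 : ContinuousAt (fun z => ‖M.eval z - M.eval z₀‖ * (|R| + 1)) z₀ :=
      (hc.sub continuousAt_const).norm.mul continuousAt_const
    exact hc2.eventually_lt continuousAt_const (by simpa using hd0)
  obtain ⟨t, hts, hcov⟩ := (isCompact_closedBall (0 : ℂ) r).elim_nhds_subcover _ hV
  refine ⟨t, t.finite_toSet, fun z hz => hsub (hts z hz), d, hd0, fun f hf hfz z hz => ?_⟩
  have hz' : z ∈ Metric.closedBall (0 : ℂ) r := by simpa using hz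
  obtain ⟨w, hw, hzw⟩ := Set.mem_iUnion₂.mp (hcov hz')
  have h1 : ‖M.incl f z - M.incl f w‖ ≤ ‖M.eval z - M.eval w‖ * ‖f‖ :=
    (M.eval z - M.eval w).le_opNorm f
  have h2 : ‖M.eval z - M.eval w‖ * ‖f‖ ≤ ‖M.eval z - M.eval w‖ * (|R| + 1) :=
    mul_le_mul_of_nonneg_left (by linarith [le_abs_self R]) (norm_nonneg _)
  have h3 : ‖M.eval z - M.eval w‖ * (|R| + 1) < d := hzw
  have h4 := hfz w hw
  have h5 := norm_le_norm_add_norm_sub' (M.incl f z) (M.incl f w)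
  have h6 : ‖M.incl f z‖ ≤ η / ν 0 := by rw [hd] at *; linarith
  calc ν z * ‖M.incl f z‖ ≤ ν 0 * (η / ν 0) :=
        mul_le_mul (RadialWeight.le_of_norm_le (hsub hz') (by simp)) h6 (norm_nonneg _) hν0.le
    _ = η := by field_simp

end HZeroModel

end WeightedSpaces

/-! ### Dilations, gliding humps and the bidual of the little space. -/

section BidualOfHZero

/-- A sequence of radii increasing to `1`. -/
def rad (n : ℕ) : ℝ := 1 - 1 / ((n : ℝ) + 2)

theorem rad_lt_one (n : ℕ) : rad n < 1 := by
  have : (0 : ℝ) < 1 / ((n : ℝ) + 2) := by positivity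
  rw [rad]
  linarith

theorem rad_pos (n : ℕ) : 0 < rad n := by
  have h : 1 / ((n : ℝ) + 2) < 1 := by
    rw [div_lt_one (by positivity)]
    linarith [(Nat.cast_nonneg n : (0 : ℝ) ≤ n)]
  rw [rad]
  linarith

theorem tendsto_rad : Tendsto rad atTop (𝓝 1) := by
  have h : Tendsto (fun n : ℕ => 1 / ((n : ℝ) + 2)) atTop (𝓝 0) :=
    tendsto_const_nhds.div_atTop
      (tendsto_atTop_add_const_right _ _ tendsto_natCast_atTop_atTop)
  have h1 := h.const_sub 1
  rw [sub_zero] at h1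
  exact h1

theorem norm_rad_mul_le (n : ℕ) (z : ℂ) : ‖(rad n : ℂ) * z‖ ≤ ‖z‖ := by
  rw [norm_mul, Complex.norm_real, Real.norm_of_nonneg (rad_pos n).le]
  exact mul_le_of_le_one_left (norm_nonneg z) (rad_lt_one n).le

theorem rad_mul_mem_disk (n : ℕ) {z : ℂ} (hz : z ∈ disk) : (rad n : ℂ) * z ∈ disk :=
  mem_disk.mpr ((norm_rad_mul_le n z).trans_lt (mem_disk.mp hz))

theorem tendsto_rad_mul (z : ℂ) : Tendsto (fun n => (rad n : ℂ) * z) atTop (𝓝 z) := by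
  have h := ((Complex.continuous_ofReal.tendsto 1).comp tendsto_rad).mul_const z
  simpa using h

variable {ν : RadialWeight}

/-- Dilations of functions in `H^∞_ν` belong to `H^0_ν`. -/
theorem exists_hZero_dilation (hν : ν.IsNormal) (f : HInf ν) (n : ℕ) :
    ∃ u ∈ HZero ν, ‖u‖ ≤ ‖f‖ ∧ ∀ z ∈ disk, u z = f ((rad n : ℂ) * z) := by
  set F : ℂ → ℂ := disk.indicator fun z => f ((rad n : ℂ) * z) with hF
  have hFz : ∀ z ∈ disk, F z = f ((rad n : ℂ) * z) := fun z hz => Set.indicator_of_mem hz _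
  have hle : ∀ z ∈ disk, ν z * ‖F z‖ ≤ ‖f‖ := by
    intro z hz
    rw [hFz z hz]
    exact (mul_le_mul_of_nonneg_right (RadialWeight.le_of_norm_le hz (norm_rad_mul_le n z))
      (norm_nonneg _)).trans (f.weight_mul_le_norm (rad_mul_mem_disk n hz))
  have hol : F ∈ Hol := by
    refine ⟨?_, fun z hz => Set.indicator_of_notMem hz _⟩
    refine DifferentiableOn.congr (f := fun z => f ((rad n : ℂ) * z)) ?_ hFz
    exact f.differentiableOn.comp (by fun_prop) fun z hz => rad_mul_mem_disk n hz
  refine ⟨⟨F, hol, ‖f‖, ?_⟩, ?_, HInf.norm_le hle, hFz⟩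
  · rintro _ ⟨z, rfl⟩
    exact hle z z.2
  · show Tendsto (fun z : ℂ => ν z * ‖F z‖) toBoundary (𝓝 0)
    have hr : (rad n : ℂ) ∈ disk := mem_disk.mpr (by
      rw [Complex.norm_real, Real.norm_of_nonneg (rad_pos n).le]; exact rad_lt_one n)
    -- The dilation is bounded by `‖f‖ / ν (rad n)` on the whole disk, and the weight vanishes at
    -- the boundary.
    have hlim := hν.tendsto_zero.mul_const (‖f‖ / ν (rad n : ℂ))
    rw [zero_mul] at hlim
    refine squeeze_zero' (eventually_mem_disk.mono fun z hz => ?_)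
      (eventually_mem_disk.mono fun z hz => ?_) hlim
    · exact mul_nonneg (ν.pos z hz).le (norm_nonneg _)
    · rw [hFz z hz]
      refine mul_le_mul_of_nonneg_left ?_ (ν.pos z hz).le
      refine (f.norm_apply_le (rad_mul_mem_disk n hz)).trans ?_
      refine div_le_div_of_nonneg_left (norm_nonneg _) (ν.pos _ hr)
        (RadialWeight.le_of_norm_le hr ?_)
      rw [norm_mul]
      exact mul_le_of_le_one_right (norm_nonneg _) (mem_disk.mp hz).le

namespace HZeroModel

variable {X : Type} [NormedAddCommGroup X] [NormedSpace ℂ X] (M : HZeroModel ν X)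

theorem exists_dilations (hν : ν.IsNormal) (f : HInf ν) : ∃ u : ℕ → X, (∀ n, ‖u n‖ ≤ ‖f‖) ∧
    ∀ n, ∀ z ∈ disk, M.incl (u n) z = f ((rad n : ℂ) * z) := by
  choose v hv hn hz using exists_hZero_dilation hν f
  choose u hu using fun n => M.exists_incl_eq (v n) (hv n)
  refine ⟨u, fun n => ?_, fun n z hzd => ?_⟩
  · rw [← M.incl.norm_map, hu]
    exact hn n
  · rw [hu]
    exact hz n z hzd

/-- The weighted moduli of the functions `h i` have sums bounded by `B` on the disk. -/
def SumsBoundedBy (h : ℕ → X) (B : ℝ) : Prop :=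
  ∀ z ∈ disk, ∀ s : Finset ℕ, ∑ i ∈ s, ν z * ‖M.incl (h i) z‖ ≤ B

variable {M}

/-- The norm is a weighted supremum of moduli, so pointwise bounds suffice: the series behaves like
the unit vectors of `c₀`. -/
theorem SumsBoundedBy.norm_sum_le {h : ℕ → X} {B : ℝ} (hB : M.SumsBoundedBy h B)
    (s : Finset ℕ) (c : ℕ → ℂ) (hc : ∀ i, ‖c i‖ ≤ 1) : ‖∑ i ∈ s, c i • h i‖ ≤ B := by
  rw [← M.incl.norm_map]
  refine HInf.norm_le fun z hz => (le_trans ?_ (hB z hz s))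
  have h1 : M.incl (∑ i ∈ s, c i • h i) z = ∑ i ∈ s, c i * M.incl (h i) z := by
    rw [← M.eval_apply, map_sum]
    exact Finset.sum_congr rfl fun i _ => by rw [map_smul, M.eval_apply, smul_eq_mul]
  rw [h1, ← Finset.mul_sum]
  refine mul_le_mul_of_nonneg_left ((_root_.norm_sum_le _ _).trans
    (Finset.sum_le_sum fun i _ => ?_)) (ν.pos z hz).le
  rw [norm_mul]
  exact mul_le_of_le_one_left (norm_nonneg _) (hc i)

/-- Unimodular coefficients turn the sum of moduli into a single value of `x'`. -/
theorem SumsBoundedBy.sum_norm_apply_le {h : ℕ → X} {B : ℝ} (hB : M.SumsBoundedBy h B)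
    (x' : StrongDual ℂ X) (s : Finset ℕ) : ∑ i ∈ s, ‖x' (h i)‖ ≤ ‖x'‖ * B := by
  choose c hc1 hc2 using fun i => Complex.exists_norm_eq_mul_self (x' (h i))
  have h1 : x' (∑ i ∈ s, c i • h i) = ((∑ i ∈ s, ‖x' (h i)‖ : ℝ) : ℂ) := by
    rw [map_sum, Complex.ofReal_sum]
    exact Finset.sum_congr rfl fun i _ => by rw [map_smul, smul_eq_mul, ← hc2]
  have h2 := x'.le_opNorm (∑ i ∈ s, c i • h i)
  rw [h1, Complex.norm_real, Real.norm_of_nonneg (Finset.sum_nonneg fun _ _ => norm_nonneg _)]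
    at h2
  exact h2.trans (mul_le_mul_of_nonneg_left (hB.norm_sum_le s c fun i => (hc1 i).le)
    (norm_nonneg _))

theorem SumsBoundedBy.comp {h : ℕ → X} {B : ℝ} (hB : M.SumsBoundedBy h B) {k : ℕ → ℕ}
    (hk : Function.Injective k) : M.SumsBoundedBy (h ∘ k) B := by
  intro z hz s
  have := hB z hz (s.map ⟨k, hk⟩)
  rwa [Finset.sum_map] at this

variable (M)

/-- Gliding humps: a bounded sequence in `H^0_ν` that tends to zero on smaller disks has a
subsequence whose weighted moduli have bounded sums. -/
theorem exists_subseq_sumsBoundedBy (h : ℕ → X) {R : ℝ} (hR : ∀ n, ‖h n‖ ≤ R)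
    (hs : ∀ n z, ‖z‖ ≤ rad n → ν z * ‖M.incl (h n) z‖ ≤ (1 / 2) ^ n) :
    ∃ k : ℕ → ℕ, StrictMono k ∧ M.SumsBoundedBy (h ∘ k) (R + 2) := by
  have hev : ∀ m, ∀ᶠ n in atTop, m < n ∧
      ∀ z, rad n < ‖z‖ → ‖z‖ < 1 → ν z * ‖M.incl (h m) z‖ ≤ (1 / 2) ^ m := by
    intro m
    obtain ⟨r, hr, hrz⟩ := tendsto_weight_mul_norm_iff.mp (M.incl_mem (h m)) ((1 / 2) ^ m)
      (by positivity)
    filter_upwards [eventually_gt_atTop m, tendsto_rad.eventually (lt_mem_nhds hr)] with n h1 h2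
    exact ⟨h1, fun z hz hz1 => (hrz z (h2.trans hz) hz1).le⟩
  -- Greedy choice: each new disk is so large that all functions already chosen are small outside
  -- it.
  obtain ⟨k, -, hk⟩ := exists_seq_of_forall_finset_exists (fun _ : ℕ => True) (fun m n => m < n ∧
      ∀ z, rad n < ‖z‖ → ‖z‖ < 1 → ν z * ‖M.incl (h m) z‖ ≤ (1 / 2) ^ m) (by
    intro s _
    obtain ⟨n, hn⟩ := ((Finset.eventually_all s).mpr fun m _ => hev m).exists
    exact ⟨n, trivial, hn⟩)
  have hmono : StrictMono k := fun i j hij => (hk i j hij).1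
  refine ⟨k, hmono, fun z hz s => ?_⟩
  have hgood : ∀ i j, i < j → ν z * ‖M.incl (h (k i)) z‖ ≤ (1 / 2) ^ i ∨
      ν z * ‖M.incl (h (k j)) z‖ ≤ (1 / 2) ^ j := by
    intro i j hij
    have hpow : ∀ i, ((1 : ℝ) / 2) ^ k i ≤ (1 / 2) ^ i := fun i =>
      pow_le_pow_of_le_one (by norm_num) (by norm_num) (hmono.le_apply)
    by_cases hzj : ‖z‖ ≤ rad (k j)
    · exact Or.inr ((hs _ z hzj).trans (hpow j))
    · exact Or.inl (((hk i j hij).2 z (not_le.mp hzj) (mem_disk.mp hz)).trans (hpow i))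
  have hR0 : 0 ≤ R := (norm_nonneg _).trans (hR 0)
  -- Of any two chosen functions at least one is small at `z`, so at most one is not. That one costs
  -- `R`, the others a geometric series with sum `2`.
  obtain ⟨i₀, hi₀⟩ : ∃ i₀, ∀ i, i ≠ i₀ → ν z * ‖M.incl (h (k i)) z‖ ≤ (1 / 2) ^ i := by
    by_cases hall : ∀ i, ν z * ‖M.incl (h (k i)) z‖ ≤ (1 / 2) ^ i
    · exact ⟨0, fun i _ => hall i⟩
    · push Not at hall
      obtain ⟨i₀, hi₀⟩ := hall
      refine ⟨i₀, fun i hne => ?_⟩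
      rcases lt_or_gt_of_ne hne with hlt | hlt
      · exact (hgood i i₀ hlt).resolve_right (not_le.mpr hi₀)
      · exact (hgood i₀ i hlt).resolve_left (not_le.mpr hi₀)
  calc ∑ i ∈ s, ν z * ‖M.incl ((h ∘ k) i) z‖
      ≤ ∑ i ∈ s, ((if i = i₀ then R else 0) + (1 / 2) ^ i) := by
        refine Finset.sum_le_sum fun i _ => ?_
        split_ifs with hi
        · exact ((M.weight_mul_le_norm _ hz).trans (hR _)).trans (by
            have : (0 : ℝ) ≤ (1 / 2) ^ i := by positivity
            linarith)
        · rw [zero_add]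
          exact hi₀ i hi
    _ ≤ R + 2 := by
        rw [Finset.sum_add_distrib]
        refine add_le_add ?_ ?_
        · rw [Finset.sum_ite_eq']
          split_ifs
          · exact le_rfl
          · exact hR0
        · exact (summable_geometric_two.sum_le_tsum s fun i _ => by positivity).trans_eq
            tsum_geometric_two

/-- Every functional on `H^0_ν` is small on bounded functions that are small on a large smaller
disk. -/
theorem exists_forall_norm_apply_le (x' : StrongDual ℂ X) (R : ℝ) {ε : ℝ} (hε : 0 < ε) :
    ∃ n, ∀ f : X, ‖f‖ ≤ R → (∀ z, ‖z‖ ≤ rad n → ν z * ‖M.incl f z‖ ≤ (1 / 2) ^ n) →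
      ‖x' f‖ ≤ ε := by
  by_contra hcon
  push Not at hcon
  choose h hR hs hx using hcon
  obtain ⟨k, -, hk⟩ := M.exists_subseq_sumsBoundedBy h hR hs
  obtain ⟨N, hN⟩ := exists_nat_gt (‖x'‖ * (R + 2) / ε)
  have h1 := hk.sum_norm_apply_le x' (Finset.range N)
  have h2 : (N : ℝ) * ε ≤ ∑ i ∈ Finset.range N, ‖x' ((h ∘ k) i)‖ := by
    have := Finset.card_nsmul_le_sum (Finset.range N) (fun i => ‖x' ((h ∘ k) i)‖) ε
      fun i _ => (hx (k i)).le
    simpa using this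
  rw [div_lt_iff₀ hε] at hN
  linarith

/-- Linear combinations of point evaluations are norm dense in the dual of `H^0_ν`. -/
theorem exists_mem_span_eval (x' : StrongDual ℂ X) {ε : ℝ} (hε : 0 < ε) :
    ∃ y' ∈ Submodule.span ℂ (M.eval '' disk), ‖x' - y'‖ ≤ ε := by
  obtain ⟨n, hn⟩ := M.exists_forall_norm_apply_le x' 1 hε
  obtain ⟨Z, hZf, hZ, d, hd, hsmall⟩ := M.exists_finite_forall_small 1 (rad_lt_one n)
    (η := (1 / 2) ^ n) (by positivity)
  have := hZf.fintype
  let L : Z → X →ₗ[ℂ] ℂ := fun z => (M.eval z : X →ₗ[ℂ] ℂ)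
  -- On the common kernel of finitely many evaluations `x'` has norm at most `ε`. Subtracting a
  -- norm-preserving extension of this restriction leaves a functional that kills `p`, hence a
  -- combination of those evaluations.
  let p : Submodule ℂ X := ⨅ z, (L z).ker
  have hp : ∀ f ∈ p, ∀ z ∈ Z, M.incl f z = 0 := fun f hf z hz =>
    (Submodule.mem_iInf _).mp hf ⟨z, hz⟩
  have hnorm : ‖x'.comp p.subtypeL‖ ≤ ε := by
    refine ContinuousLinearMap.opNorm_le_bound _ hε.le fun f => ?_
    have := LinearMap.bound_of_ball_bound' (𝕜 := ℂ) one_pos ε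
      (x'.comp p.subtypeL : p →ₗ[ℂ] ℂ) (fun f hf => ?_) f
    · simpa using this
    · have hf1 : ‖(f : X)‖ ≤ 1 := by simpa using hf
      exact hn f hf1 (hsmall f hf1 fun z hz => by rw [hp f f.2 z hz, norm_zero]; exact hd.le)
  obtain ⟨y', hy', hyn⟩ := exists_extension_norm_eq p (x'.comp p.subtypeL)
  have hker : p ≤ ((x' - y' : StrongDual ℂ X) : X →ₗ[ℂ] ℂ).ker := by
    intro f hf
    have : y' f = x' f := hy' ⟨f, hf⟩
    simp [this]
  obtain ⟨c, hc⟩ := (Submodule.mem_span_range_iff_exists_fun ℂ).mp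
    (mem_span_of_iInf_ker_le_ker hker)
  have hsum : x' - y' = ∑ z, c z • M.eval z := by
    ext f
    rw [← ContinuousLinearMap.coe_coe, ← hc]
    simp [L]
  refine ⟨x' - y', ?_, by rw [sub_sub_cancel, hyn]; exact hnorm⟩
  rw [hsum]
  exact Submodule.sum_mem _ fun z _ => Submodule.smul_mem _ _
    (Submodule.subset_span ⟨z, hZ z.2, rfl⟩)

/-- Bounded sequences in the bidual converge weak-star as soon as they converge at all point
evaluations. -/
theorem tendsto_of_tendsto_eval {u : ℕ → Bidual X} {R : ℝ} (hu : ∀ n, ‖u n‖ ≤ R) {F : Bidual X}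
    (h : ∀ z ∈ disk, Tendsto (fun n => u n (M.eval z)) atTop (𝓝 (F (M.eval z))))
    (x' : StrongDual ℂ X) : Tendsto (fun n => u n x') atTop (𝓝 (F x')) := by
  have hspan : ∀ y' ∈ Submodule.span ℂ (M.eval '' disk),
      Tendsto (fun n => u n y') atTop (𝓝 (F y')) := by
    intro y' hy'
    induction hy' using Submodule.span_induction with
    | mem y' hy =>
      obtain ⟨z, hz, rfl⟩ := hy
      exact h z hz
    | zero => simp
    | add a b _ _ ha hb => simpa using ha.add hb
    | smul c a _ ha => simpa using ha.const_mul c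
  rw [Metric.tendsto_atTop]
  intro ε hε
  have hR0 : 0 ≤ R := (norm_nonneg (u 0)).trans (hu 0)
  have hK : 0 < R + ‖F‖ + 1 := by positivity
  obtain ⟨y', hy', hxy⟩ := M.exists_mem_span_eval x' (ε := ε / 2 / (R + ‖F‖ + 1)) (by positivity)
  obtain ⟨N, hN⟩ := Metric.tendsto_atTop.mp (hspan y' hy') (ε / 2) (by positivity)
  refine ⟨N, fun n hn => ?_⟩
  have h1 := hN n hn
  have h2 : ‖u n (x' - y')‖ ≤ R * ‖x' - y'‖ := (u n).le_of_opNorm_le (hu n) _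
  have h3 : ‖F (x' - y')‖ ≤ ‖F‖ * ‖x' - y'‖ := F.le_opNorm _
  have h4 : (R + ‖F‖) * ‖x' - y'‖ ≤ ε / 2 := by
    calc (R + ‖F‖) * ‖x' - y'‖ ≤ (R + ‖F‖ + 1) * (ε / 2 / (R + ‖F‖ + 1)) :=
          mul_le_mul (by linarith) hxy (norm_nonneg _) hK.le
      _ = ε / 2 := by field_simp
  rw [dist_eq_norm] at h1 ⊢
  have h5 : u n x' - F x' = u n (x' - y') + (u n y' - F y') - F (x' - y') := by
    rw [map_sub, map_sub]; ring
  rw [h5]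
  have h6 := norm_sub_le (u n (x' - y') + (u n y' - F y')) (F (x' - y'))
  have h7 := norm_add_le (u n (x' - y')) (u n y' - F y')
  linarith

theorem bidual_ext {F G : Bidual X} (h : ∀ z ∈ disk, F (M.eval z) = G (M.eval z)) : F = G := by
  ext x'
  exact tendsto_nhds_unique tendsto_const_nhds
    (M.tendsto_of_tendsto_eval (u := fun _ => F) (fun _ => le_rfl)
      (fun z hz => by rw [h z hz]; exact tendsto_const_nhds) _)

/-- The linear map `F ↦ (z ↦ F(δ_z))` from the bidual of `H^0_ν` to `H^∞_ν`. -/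
def ofBidual : Bidual X →ₗ[ℂ] HInf ν where
  toFun F := ⟨fun z => F (M.eval z),
    ⟨F.differentiable.comp_differentiableOn M.differentiableOn_eval,
    fun z hz => by
      have : M.eval z = 0 := by ext f; exact (M.incl f).apply_eq_zero hz
      show F (M.eval z) = 0
      rw [this, map_zero]⟩, ‖F‖, by
    rintro _ ⟨z, rfl⟩
    have h1 := mul_le_mul_of_nonneg_left (F.le_opNorm (M.eval z)) (ν.pos z z.2).le
    have h2 := mul_le_mul_of_nonneg_left (M.weight_mul_norm_eval_le z.2) (norm_nonneg F)
    simp only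
    linarith⟩
  map_add' _ _ := rfl
  map_smul' _ _ := rfl

theorem ofBidual_apply (F : Bidual X) (z : ℂ) : M.ofBidual F z = F (M.eval z) := rfl

theorem norm_ofBidual_le (F : Bidual X) : ‖M.ofBidual F‖ ≤ ‖F‖ := by
  refine HInf.norm_le fun z hz => ?_
  have h1 := mul_le_mul_of_nonneg_left (F.le_opNorm (M.eval z)) (ν.pos z hz).le
  have h2 := mul_le_mul_of_nonneg_left (M.weight_mul_norm_eval_le hz) (norm_nonneg F)
  rw [ofBidual_apply]
  linarith

/-- The preimage is a weak-star limit of the dilations of `f`, which keeps their norm bound; so the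
inverse of `ofBidual` is bounded by `1`. -/
theorem exists_ofBidual_eq (hν : ν.IsNormal) (f : HInf ν) :
    ∃ F : Bidual X, ‖F‖ ≤ ‖f‖ ∧ M.ofBidual F = f := by
  obtain ⟨u, hu, huz⟩ := M.exists_dilations hν f
  obtain ⟨F, hF, hlim⟩ := exists_weakStar_limit (hyperfilter ℕ)
    (fun n => NormedSpace.inclusionInDoubleDual ℂ X (u n)) (R := ‖f‖)
    (fun n => (NormedSpace.double_dual_bound ℂ X (u n)).trans (hu n))
  refine ⟨F, hF, HInf.ext fun z hz => ?_⟩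
  have h1 : Tendsto (fun n => M.eval z (u n)) atTop (𝓝 (f z)) := by
    have hc : ContinuousAt f z :=
      f.differentiableOn.continuousOn.continuousAt (Metric.isOpen_ball.mem_nhds hz)
    exact (hc.tendsto.comp (tendsto_rad_mul z)).congr fun n => (huz n z hz).symm
  exact tendsto_nhds_unique (hlim (M.eval z)) (h1.mono_left Nat.hyperfilter_le_atTop)

theorem ofBidual_bijective (hν : ν.IsNormal) : Function.Bijective M.ofBidual := by
  refine ⟨fun F G h => M.bidual_ext fun z _ => ?_, fun f => ?_⟩
  · rw [← ofBidual_apply, h, ofBidual_apply]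
  · obtain ⟨F, -, hF⟩ := M.exists_ofBidual_eq hν f
    exact ⟨F, hF⟩

/-- The map `F ↦ (z ↦ F(δ_z))` as a linear equivalence. -/
def bidualLinearEquiv (hν : ν.IsNormal) : Bidual X ≃ₗ[ℂ] HInf ν :=
  LinearEquiv.ofBijective M.ofBidual (M.ofBidual_bijective hν)

/-- The bidual of `H^0_ν` is `H^∞_ν`. -/
def bidualEquiv (hν : ν.IsNormal) : Bidual X ≃L[ℂ] HInf ν :=
  (M.bidualLinearEquiv hν).toContinuousLinearEquivOfBounds 1 1
    (fun F => (M.norm_ofBidual_le F).trans_eq (one_mul _).symm) (fun f => by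
      obtain ⟨F, hF, rfl⟩ := M.exists_ofBidual_eq hν f
      have h : (M.bidualLinearEquiv hν).symm (M.ofBidual F) = F :=
        (M.bidualLinearEquiv hν).symm_apply_apply F
      rw [one_mul, h]
      exact hF)

theorem bidualEquiv_apply (hν : ν.IsNormal) (F : Bidual X) (z : ℂ) :
    M.bidualEquiv hν F z = F (M.eval z) := rfl

theorem bidualEquiv_inclusion (hν : ν.IsNormal) (f : X) :
    M.bidualEquiv hν (NormedSpace.inclusionInDoubleDual ℂ X f) = M.incl f := rfl

/-- An element of the bidual is the weak-star limit of a bounded sequence of dilations. -/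
theorem tendsto_dilations (hν : ν.IsNormal) (F : Bidual X) {u : ℕ → X} {R : ℝ}
    (hu : ∀ n, ‖u n‖ ≤ R)
    (huz : ∀ n, ∀ z ∈ disk, M.incl (u n) z = M.bidualEquiv hν F ((rad n : ℂ) * z))
    (x' : StrongDual ℂ X) : Tendsto (fun n => x' (u n)) atTop (𝓝 (F x')) := by
  refine M.tendsto_of_tendsto_eval (u := fun n => NormedSpace.inclusionInDoubleDual ℂ X (u n))
    (fun n => (NormedSpace.double_dual_bound ℂ X (u n)).trans (hu n)) (fun z hz => ?_) x'
  have hc : ContinuousAt (M.bidualEquiv hν F) z :=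
    (M.bidualEquiv hν F).differentiableOn.continuousOn.continuousAt
      (Metric.isOpen_ball.mem_nhds hz)
  exact (hc.tendsto.comp (tendsto_rad_mul z)).congr fun n => (huz n z hz).symm

theorem completeSpace_hInf (M : HZeroModel ν X) (hν : ν.IsNormal) : CompleteSpace (HInf ν) := 
  completeSpace_of_equiv (E := Bidual X) (M.bidualEquiv hν)

end HZeroModel

end BidualOfHZero

/-! ### Operators whose bi-transpose has range in the target space. -/

section CompactOperators

theorem bitranspose_apply {X Y : Type} [NormedAddCommGroup X] [NormedSpace ℂ X]
    [NormedAddCommGroup Y] [NormedSpace ℂ Y] (T : X →L[ℂ] Y) (F : Bidual X)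
    (y' : StrongDual ℂ Y) : bitranspose T F y' = F (y'.comp T) := rfl

variable {ν : RadialWeight}

namespace HZeroModel

variable {X : Type} [NormedAddCommGroup X] [NormedSpace ℂ X] {M : HZeroModel ν X}

theorem SumsBoundedBy.summable {h : ℕ → X} {B : ℝ} (hB : M.SumsBoundedBy h B)
    (x' : StrongDual ℂ X) : Summable fun i => ‖x' (h i)‖ :=
  summable_of_sum_le (fun _ => norm_nonneg _) (hB.sum_norm_apply_le _)

/-- The subseries `∑_{i ∈ A} h i` converges weak-star along an ultrafilter in the bidual. -/
theorem SumsBoundedBy.exists_bidual_sum {h : ℕ → X} {B : ℝ} (hB : M.SumsBoundedBy h B)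
    (A : Set ℕ) : ∃ F : Bidual X, ∀ x' : StrongDual ℂ X,
      Tendsto (fun N => ∑ i ∈ Finset.range N, A.indicator 1 i * x' (h i)) (hyperfilter ℕ)
        (𝓝 (F x')) := by
  have hA : ∀ i, ‖A.indicator (1 : ℕ → ℂ) i‖ ≤ 1 := fun i => by
    by_cases hi : i ∈ A <;> simp [hi]
  obtain ⟨F, -, hF⟩ := exists_weakStar_limit (hyperfilter ℕ)
    (fun N => NormedSpace.inclusionInDoubleDual ℂ X
      (∑ i ∈ Finset.range N, A.indicator (1 : ℕ → ℂ) i • h i)) (R := B)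
    (fun N => (NormedSpace.double_dual_bound ℂ X _).trans
      (hB.norm_sum_le _ _ hA))
  refine ⟨F, fun x' => (hF x').congr fun N => ?_⟩
  rw [NormedSpace.dual_def, map_sum]
  exact Finset.sum_congr rfl fun i _ => by rw [map_smul, smul_eq_mul]

/-- Functionals that do not tend to zero on a weakly unconditionally Cauchy series can be
modified and thinned out so as to become almost biorthogonal to it. -/
theorem SumsBoundedBy.exists_almost_biorthogonal {h : ℕ → X} {B : ℝ} (hB : M.SumsBoundedBy h B)
    {Y : Type} [NormedAddCommGroup Y] [NormedSpace ℂ Y] (T : X →L[ℂ] Y) {ε : ℝ} (hε : 0 < ε)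
    (hT : ∀ i, ε ≤ ‖T (h i)‖) :
    ∃ k : ℕ → ℕ, StrictMono k ∧ ∃ w : ℕ → StrongDual ℂ Y, (∀ j, ‖w j‖ ≤ 2) ∧
      (∀ j, ε / 2 ≤ ‖w j (T (h (k j)))‖) ∧
      ∀ j, ∀ s : Finset ℕ, j ∉ s → ∑ i ∈ s, ‖w j (T (h (k i)))‖ ≤ ε / 4 := by
  choose v hv1 hv2 using fun i => exists_dual_vector'' ℂ (T (h i))
  obtain ⟨y, hy1, hy⟩ := exists_weakStar_limit (hyperfilter ℕ) v hv1
  -- Subtracting the weak-star limit makes `w n` tend to zero on each fixed `T (h m)`. It costs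
  -- little on the diagonal, since `y (T (h n))` is summable and hence tends to `0`.
  set w : ℕ → StrongDual ℂ Y := fun n => v n - y with hw
  have hsum : ∀ m, Summable fun i => ‖w m (T (h i))‖ := fun m => hB.summable ((w m).comp T)
  have hlim : ∀ m, Tendsto (fun n => w n (T (h m))) (hyperfilter ℕ) (𝓝 0) := fun m => by
    simpa [hw] using (hy (T (h m))).sub_const (y (T (h m)))
  have hdiag : ∀ᶠ n in atTop, ε / 2 ≤ ‖w n (T (h n))‖ := by
    have h0 := (hB.summable (y.comp T)).tendsto_atTop_zero
    filter_upwards [h0.eventually (gt_mem_nhds (half_pos hε))] with n hn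
    have h1 := norm_sub_norm_le (v n (T (h n))) (y (T (h n)))
    have h2 : ‖v n (T (h n))‖ = ‖T (h n)‖ := by rw [hv2]; simp
    have h3 : ‖y (T (h n))‖ < ε / 2 := hn
    have h4 : w n (T (h n)) = v n (T (h n)) - y (T (h n)) := rfl
    rw [h4]
    linarith [hT n]
  have hrel : ∀ m, ∀ᶠ n in hyperfilter ℕ, m < n ∧ ‖w n (T (h m))‖ ≤ ε / 16 * (1 / 2) ^ m ∧
      ∀ s : Finset ℕ, (∀ i ∈ s, n ≤ i) → ∑ i ∈ s, ‖w m (T (h i))‖ ≤ ε / 16 := by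
    intro m
    obtain ⟨t, ht⟩ := summable_iff_vanishing_norm.mp (hsum m) (ε / 16) (by positivity)
    have h1 : ∀ᶠ n in hyperfilter ℕ, m < n :=
      Nat.hyperfilter_le_atTop (eventually_gt_atTop m)
    have h2 : ∀ᶠ n in hyperfilter ℕ, ∀ i ∈ t, i < n :=
      Nat.hyperfilter_le_atTop ((Finset.eventually_all t).mpr fun i _ => eventually_gt_atTop i)
    have h3 : ∀ᶠ n in hyperfilter ℕ, ‖w n (T (h m))‖ < ε / 16 * (1 / 2) ^ m := by
      have := (hlim m).norm
      rw [norm_zero] at this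
      exact this.eventually (gt_mem_nhds (by positivity))
    filter_upwards [h1, h2, h3] with n hn1 hn2 hn3
    refine ⟨hn1, hn3.le, fun s hs => ?_⟩
    have h4 := ht s (Finset.disjoint_left.mpr fun i his hit =>
      absurd (hs i his) (not_le.mpr (hn2 i hit)))
    exact (le_abs_self _).trans h4.le
  obtain ⟨k, hkP, hk⟩ := exists_seq_of_forall_finset_exists
    (fun n => ε / 2 ≤ ‖w n (T (h n))‖)
    (fun m n => m < n ∧ ‖w n (T (h m))‖ ≤ ε / 16 * (1 / 2) ^ m ∧
      ∀ s : Finset ℕ, (∀ i ∈ s, n ≤ i) → ∑ i ∈ s, ‖w m (T (h i))‖ ≤ ε / 16) (by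
    intro s _
    obtain ⟨n, hn⟩ := (((Finset.eventually_all s).mpr fun m _ => hrel m).and
      (Nat.hyperfilter_le_atTop hdiag)).exists
    exact ⟨n, hn.2, hn.1⟩)
  have hmono : StrictMono k := fun i j hij => (hk i j hij).1
  refine ⟨k, hmono, w ∘ k, fun j => ?_, hkP, fun j s hj => ?_⟩
  · refine (norm_sub_le (v (k j)) y).trans ?_
    linarith [hv1 (k j)]
  -- Earlier indices contribute at most `ε / 8`, later ones at most `ε / 16`.
  · rw [← Finset.sum_filter_add_sum_filter_not s (· < j)]
    have hlow : ∑ i ∈ s with i < j, ‖(w ∘ k) j (T (h (k i)))‖ ≤ ε / 16 * 2 := by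
      calc ∑ i ∈ s with i < j, ‖(w ∘ k) j (T (h (k i)))‖
          ≤ ∑ i ∈ s with i < j, ε / 16 * (1 / 2) ^ i := by
            refine Finset.sum_le_sum fun i hi => ?_
            refine ((hk i j (Finset.mem_filter.mp hi).2).2.1).trans ?_
            exact mul_le_mul_of_nonneg_left (pow_le_pow_of_le_one (by norm_num) (by norm_num)
              hmono.le_apply) (by positivity)
        _ ≤ ε / 16 * 2 := by
            rw [← Finset.mul_sum]
            exact mul_le_mul_of_nonneg_left ((summable_geometric_two.sum_le_tsum _
              fun i _ => by positivity).trans_eq tsum_geometric_two) (by positivity)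
    have hhigh : ∑ i ∈ s with ¬ i < j, ‖(w ∘ k) j (T (h (k i)))‖ ≤ ε / 16 := by
      -- The tail of `w (k j)` was controlled when `k (j + 1)` was chosen.
      have h1 := (hk j (j + 1) (Nat.lt_succ_self j)).2.2
        ((s.filter (¬ · < j)).map ⟨k, hmono.injective⟩) (by
        intro i hi
        obtain ⟨l, hl, rfl⟩ := Finset.mem_map.mp hi
        obtain ⟨hls, hlj⟩ := Finset.mem_filter.mp hl
        refine hmono.monotone ?_
        have : l ≠ j := fun h => hj (h ▸ hls)
        omega)
      rwa [Finset.sum_map] at h1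
    linarith

variable (M)

/-- An operator on `H^0_ν` whose bi-transpose has range in `Y` is small on bounded functions that
are small on a large smaller disk. -/
theorem exists_forall_norm_map_le {Y : Type} [NormedAddCommGroup Y] [NormedSpace ℂ Y]
    (T : X →L[ℂ] Y)
    (hT : ∀ F, ∃ y, bitranspose T F = NormedSpace.inclusionInDoubleDual ℂ Y y)
    (R : ℝ) {ε : ℝ} (hε : 0 < ε) :
    ∃ n, ∀ f : X, ‖f‖ ≤ R → (∀ z, ‖z‖ ≤ rad n → ν z * ‖M.incl f z‖ ≤ (1 / 2) ^ n) →
      ‖T f‖ ≤ ε := by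
  by_contra hcon
  push Not at hcon
  choose h₀ hR hs hx using hcon
  obtain ⟨k₀, -, hk₀⟩ := M.exists_subseq_sumsBoundedBy h₀ hR hs
  obtain ⟨k, hk, w, hw2, hdiag, hoff⟩ := hk₀.exists_almost_biorthogonal T hε
    fun i => (hx (k₀ i)).le
  set h : ℕ → X := fun i => (h₀ ∘ k₀) (k i) with hh
  have hB : M.SumsBoundedBy h (R + 2) := hk₀.comp hk.injective
  choose F hF using hB.exists_bidual_sum
  choose y hy using fun A => hT (F A)
  have hlim : ∀ A (y' : StrongDual ℂ Y), Tendsto (fun N => ∑ i ∈ Finset.range N,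
      A.indicator 1 i * y' (T (h i))) (hyperfilter ℕ) (𝓝 (y' (y A))) := by
    intro A y'
    have h1 : y' (y A) = F A (y'.comp T) := by
      rw [← bitranspose_apply, hy, NormedSpace.dual_def]
    rw [h1]
    exact hF A (y'.comp T)
  refine not_separated_of_mem_closure_span (fun i => T (h i)) y (c := ε / 8) (by positivity)
    (fun A => ?_) (fun A B hAB => ?_)
  -- A functional killing every `T (h i)` kills the partial sums, hence `y A`.
  · refine mem_of_forall_dual_eq_zero _ (Submodule.isClosed_topologicalClosure _) fun y' hy' => ?_
    refine tendsto_nhds_unique (hlim A y') (tendsto_const_nhds.congr fun N => ?_)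
    refine (Finset.sum_eq_zero fun i _ => ?_).symm
    rw [hy' _ (Submodule.le_topologicalClosure _ (Submodule.subset_span ⟨i, rfl⟩)), mul_zero]
  · obtain ⟨j, hj⟩ : ∃ j, ¬ (j ∈ A ↔ j ∈ B) := by
      by_contra hno
      push Not at hno
      exact hAB (Set.ext hno)
    set c : ℕ → ℂ := fun i => A.indicator 1 i - B.indicator 1 i with hc
    have hcj : ‖c j‖ = 1 := by
      by_cases h1 : j ∈ A <;> by_cases h2 : j ∈ B <;> simp_all
    have hc1 : ∀ i, ‖c i‖ ≤ 1 := fun i => by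
      by_cases h1 : i ∈ A <;> by_cases h2 : i ∈ B <;> simp [hc, h1, h2]
    have hd : Tendsto (fun N => ∑ i ∈ Finset.range N, c i * w j (T (h i))) (hyperfilter ℕ)
        (𝓝 (w j (y A - y B))) := by
      rw [map_sub]
      refine ((hlim A (w j)).sub (hlim B (w j))).congr fun N => ?_
      rw [← Finset.sum_sub_distrib]
      exact Finset.sum_congr rfl fun i _ => by rw [hc]; ring
    -- The diagonal term is at least `ε / 2`, the rest at most `ε / 4`; the bound `‖w j‖ ≤ 2` then
    -- yields separation `ε / 8`.
    have hge : ε / 4 ≤ ‖w j (y A - y B)‖ := by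
      refine ge_of_tendsto hd.norm (Nat.hyperfilter_le_atTop ?_)
      filter_upwards [eventually_gt_atTop j] with N hN
      rw [← Finset.add_sum_erase _ _ (Finset.mem_range.mpr hN)]
      have h1 := norm_sub_le_norm_add (c j * w j (T (h j)))
        (∑ i ∈ (Finset.range N).erase j, c i * w j (T (h i)))
      have h2 : ‖∑ i ∈ (Finset.range N).erase j, c i * w j (T (h i))‖ ≤ ε / 4 := by
        refine (norm_sum_le _ _).trans (le_trans (Finset.sum_le_sum fun i _ => ?_)
          (hoff j ((Finset.range N).erase j) (Finset.notMem_erase j _)))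
        rw [norm_mul]
        exact mul_le_of_le_one_left (norm_nonneg _) (hc1 i)
      have h3 : ‖c j * w j (T (h j))‖ = ‖w j (T (h j))‖ := by rw [norm_mul, hcj, one_mul]
      have h4 := hdiag j
      have h5 : ε / 2 ≤ ‖w j (T (h j))‖ := h4
      linarith
    have hle : ‖w j (y A - y B)‖ ≤ 2 * ‖y A - y B‖ := (w j).le_of_opNorm_le (hw2 j) _
    linarith

/-- An operator on `H^0_ν` whose bi-transpose has range in `Y` is compact. -/
theorem isCompactOperator_of_bitranspose (M : HZeroModel ν X) {Y : Type}
    [NormedAddCommGroup Y] [NormedSpace ℂ Y]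
    [CompleteSpace Y] (T : X →L[ℂ] Y)
    (hT : ∀ F, ∃ y, bitranspose T F = NormedSpace.inclusionInDoubleDual ℂ Y y) :
    IsCompactOperator T := by
  refine (isCompactOperator_iff_isCompact_closure_image_closedBall (T : X →ₗ[ℂ] Y)
    one_pos).mpr ?_
  refine TotallyBounded.isCompact_of_isClosed (TotallyBounded.closure ?_) isClosed_closure
  refine Metric.totallyBounded_of_finite_discretization fun ε hε => ?_
  -- The radius is `2` because differences of unit-ball elements are tested: if they nearly agree on
  -- the finite set `Z`, their images are close. Values on `Z` lie in a finite-dimensional space,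
  -- where bounded sets have finite nets.
  obtain ⟨n, hn⟩ := M.exists_forall_norm_map_le T hT 2 (half_pos hε)
  obtain ⟨Z, hZf, hZ, d, hd, hsmall⟩ := M.exists_finite_forall_small 2 (rad_lt_one n)
    (η := (1 / 2) ^ n) (by positivity)
  have := hZf.fintype
  let E : X → Z → ℂ := fun f z => M.incl f z
  have hbdd : TotallyBounded (E '' Metric.closedBall 0 1) := by
    suffices hb : Bornology.IsBounded (E '' Metric.closedBall 0 1) from
      hb.isCompact_closure.totallyBounded.subset subset_closure
    refine isBounded_iff_forall_norm_le.mpr ⟨∑ z : Z, 1 / ν z, ?_⟩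
    rintro _ ⟨f, hf, rfl⟩
    have hpos : ∀ z : Z, 0 ≤ 1 / ν z := fun z => (div_pos one_pos (ν.pos z (hZ z.2))).le
    refine (pi_norm_le_iff_of_nonneg (Finset.sum_nonneg fun z _ => hpos z)).mpr fun z => ?_
    refine le_trans ?_ (Finset.single_le_sum (f := fun z : Z => 1 / ν z)
      (fun z _ => hpos z) (Finset.mem_univ z))
    refine (M.norm_apply_le f (hZ z.2)).trans ?_
    exact div_le_div_of_nonneg_right (by simpa using hf) (ν.pos z (hZ z.2)).le
  obtain ⟨t, htf, ht⟩ := Metric.totallyBounded_iff.mp hbdd (d / 2) (half_pos hd)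
  have hpre : ∀ x : ((T : X →ₗ[ℂ] Y) '' Metric.closedBall 0 1 : Set Y),
      ∃ f : X, ‖f‖ ≤ 1 ∧ T f = x ∧ ∃ c : t, dist (E f) c < d / 2 := by
    rintro ⟨_, f, hf, rfl⟩
    obtain ⟨c, hc, hfc⟩ := Set.mem_iUnion₂.mp (ht ⟨f, hf, rfl⟩)
    exact ⟨f, by simpa using hf, rfl, ⟨c, hc⟩, hfc⟩
  choose p hp1 hpT c hc using hpre
  refine ⟨t, htf.fintype, c, fun x y hxy => ?_⟩
  rw [← hpT x, ← hpT y, dist_eq_norm, ← map_sub]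
  have hEd : dist (E (p x)) (E (p y)) < d := by
    have h1 := dist_triangle_right (E (p x)) (E (p y)) (c x)
    have h2 := hc x
    have h3 := hc y
    rw [← hxy] at h3
    linarith
  have hnorm : ‖p x - p y‖ ≤ 2 := (norm_sub_le _ _).trans (by linarith [hp1 x, hp1 y])
  refine (hn _ hnorm (hsmall _ hnorm fun z hz => ?_)).trans_lt (half_lt_self hε)
  have h1 := (dist_le_pi_dist (E (p x)) (E (p y)) ⟨z, hz⟩).trans hEd.le
  rw [dist_eq_norm] at h1
  rw [map_sub]
  exact h1

/-- The bi-transpose of a weakly compact operator on `H^0_ν` has range in `Y`. -/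
theorem exists_bitranspose_eq (M : HZeroModel ν X) (hν : ν.IsNormal) {Y : Type}
    [NormedAddCommGroup Y] [NormedSpace ℂ Y] (T : X →L[ℂ] Y) (hT : IsWeaklyCompactOp T)
    (F : Bidual X) :
    ∃ y, bitranspose T F = NormedSpace.inclusionInDoubleDual ℂ Y y := by
  obtain ⟨u, hu, huz⟩ := M.exists_dilations hν (M.bidualEquiv hν F)
  set R := ‖M.bidualEquiv hν F‖ + 1 with hR
  have hR0 : 0 < R := by positivity
  have hRc : (R : ℂ) ≠ 0 := by exact_mod_cast hR0.ne'
  let a : ℕ → WeakSpace ℂ Y := fun n => toWeakSpace ℂ Y (T ((R : ℂ)⁻¹ • u n))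
  have ha : ∀ n, a n ∈ closure (toWeakSpace ℂ Y '' (T '' Metric.closedBall (0 : X) 1)) := by
    intro n
    refine subset_closure ⟨_, ⟨_, ?_, rfl⟩, rfl⟩
    rw [mem_closedBall_zero_iff, norm_smul, norm_inv, Complex.norm_real,
      Real.norm_of_nonneg hR0.le, inv_mul_le_one₀ hR0]
    linarith [hu n]
  -- The rescaled images of the dilations have a weak limit in `Y`; by weak-star convergence of the
  -- dilations it represents the bi-transpose at `F`.
  obtain ⟨y, -, hy⟩ := isCompact_iff_ultrafilter_le_nhds.mp hT ((hyperfilter ℕ).map a) (by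
    rw [le_principal_iff, Ultrafilter.coe_map, mem_map]
    exact univ_mem' ha)
  refine ⟨(R : ℂ) • (toWeakSpace ℂ Y).symm y, ?_⟩
  ext y'
  have h1 : Tendsto (fun n => y' (T ((R : ℂ)⁻¹ • u n))) (hyperfilter ℕ)
      (𝓝 (y' ((toWeakSpace ℂ Y).symm y))) :=
    ((WeakBilin.eval_continuous (topDualPairing ℂ Y).flip y').tendsto y).comp hy
  have h2 : Tendsto (fun n => y' (T (u n))) (hyperfilter ℕ) (𝓝 (F (y'.comp T))) :=
    (M.tendsto_dilations hν F hu huz (y'.comp T)).mono_left Nat.hyperfilter_le_atTop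
  have h3 := h1.const_mul (R : ℂ)
  rw [bitranspose_apply, NormedSpace.dual_def, map_smul, smul_eq_mul]
  refine tendsto_nhds_unique h2 (h3.congr fun n => ?_)
  rw [map_smul, map_smul, smul_eq_mul, mul_inv_cancel_left₀ hRc]

end HZeroModel

/-- A norm-compact set is compact, hence closed, in the weak topology, so it contains the weak
closure. -/
theorem isWeaklyCompactOp_of_isCompactOperator {X Y : Type} [NormedAddCommGroup X]
    [NormedSpace ℂ X] [NormedAddCommGroup Y] [NormedSpace ℂ Y] {T : X →L[ℂ] Y}
    (hT : IsCompactOperator T) : IsWeaklyCompactOp T := by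
  have hK := (isCompactOperator_iff_isCompact_closure_image_closedBall (T : X →ₗ[ℂ] Y)
    one_pos).mp hT
  have hKw := hK.image (toWeakSpaceCLM ℂ Y).continuous
  refine hKw.of_isClosed_subset isClosed_closure
    (closure_minimal ?_ hKw.isClosed)
  rintro _ ⟨x, hx, rfl⟩
  exact ⟨x, subset_closure hx, rfl⟩

end CompactOperators

/-! ### The Volterra operator on the large space and its relation to dilations. -/

section Extension

theorem ofReal_mul_mem_disk {z : ℂ} (hz : z ∈ disk) {t : ℝ} (ht : t ∈ Set.Icc (0 : ℝ) 1) :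
    (t : ℂ) * z ∈ disk := by
  rw [mem_disk, norm_mul, Complex.norm_real, Real.norm_of_nonneg ht.1]
  exact (mul_le_of_le_one_left (norm_nonneg z) ht.2).trans_lt (mem_disk.mp hz)

section Volterra

variable {g φ : ℂ → ℂ}


theorem continuousOn_volterra_integrand (hg : DifferentiableOn ℂ g disk)
    (hφ : DifferentiableOn ℂ φ disk) (hφmaps : Set.MapsTo φ disk disk) {f : ℂ → ℂ}
    (hf : ContinuousOn f disk) {z : ℂ} (hz : z ∈ disk) :
    ContinuousOn (fun t : ℝ => f (φ ((t : ℂ) * z)) * deriv g ((t : ℂ) * z) * z)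
      (Set.Icc 0 1) := by
  have hseg : ContinuousOn (fun t : ℝ => (t : ℂ) * z) (Set.Icc 0 1) := by fun_prop
  have hmaps : Set.MapsTo (fun t : ℝ => (t : ℂ) * z) (Set.Icc 0 1) disk :=
    fun t ht => ofReal_mul_mem_disk hz ht
  have h1 : ContinuousOn (fun t : ℝ => f (φ ((t : ℂ) * z))) (Set.Icc 0 1) :=
    (hf.comp hφ.continuousOn hφmaps).comp hseg hmaps
  have h2 : ContinuousOn (fun t : ℝ => deriv g ((t : ℂ) * z)) (Set.Icc 0 1) :=
    (hg.deriv Metric.isOpen_ball).continuousOn.comp hseg hmaps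
  exact (h1.mul h2).mul continuousOn_const

theorem intervalIntegrable_volterra_integrand (hg : DifferentiableOn ℂ g disk)
    (hφ : DifferentiableOn ℂ φ disk) (hφmaps : Set.MapsTo φ disk disk) {f : ℂ → ℂ}
    (hf : ContinuousOn f disk) {z : ℂ} (hz : z ∈ disk) :
    IntervalIntegrable (fun t : ℝ => f (φ ((t : ℂ) * z)) * deriv g ((t : ℂ) * z) * z)
      MeasureTheory.volume 0 1 := by
  refine ContinuousOn.intervalIntegrable ?_
  rw [Set.uIcc_of_le zero_le_one]
  exact continuousOn_volterra_integrand hg hφ hφmaps hf hz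

/-- The integrand has a primitive on the disk, and the segment integral is its increment from `0`.
-/
theorem differentiableOn_volterra (hg : DifferentiableOn ℂ g disk)
    (hφ : DifferentiableOn ℂ φ disk) (hφmaps : Set.MapsTo φ disk disk) {f : ℂ → ℂ}
    (hf : DifferentiableOn ℂ f disk) : DifferentiableOn ℂ (volterra g φ f) disk := by
  have hh : DifferentiableOn ℂ (fun w => f (φ w) * deriv g w) disk :=
    (hf.comp hφ hφmaps).mul (hg.deriv Metric.isOpen_ball)
  obtain ⟨H, hH⟩ := hh.isExactOn_ball
  have heq : ∀ z ∈ disk, volterra g φ f z = H z - H 0 := by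
    intro z hz
    have hderiv : ∀ t ∈ Set.uIcc (0 : ℝ) 1, HasDerivAt (fun t : ℝ => H ((t : ℂ) * z))
        (f (φ ((t : ℂ) * z)) * deriv g ((t : ℂ) * z) * z) t := by
      intro t ht
      rw [Set.uIcc_of_le zero_le_one] at ht
      have h1 := hH _ (ofReal_mul_mem_disk hz ht)
      have h2 : HasDerivAt (fun w : ℂ => w * z) z (t : ℂ) := by
        simpa using (hasDerivAt_id (t : ℂ)).mul_const z
      exact (HasDerivAt.comp (t : ℂ) h1 h2).comp_ofReal
    have := intervalIntegral.integral_eq_sub_of_hasDerivAt hderiv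
      (intervalIntegrable_volterra_integrand hg hφ hφmaps hf.continuousOn hz)
    rw [Complex.ofReal_one, one_mul, Complex.ofReal_zero, zero_mul] at this
    exact this
  refine DifferentiableOn.congr (f := fun z => H z - H 0) ?_ heq
  exact fun z hz => ((hH z hz).differentiableAt.sub_const _).differentiableWithinAt

/-- Dominated convergence: dilating moves points towards the origin, where the weight is larger, so
one majorant serves all `n`. -/
theorem tendsto_volterra_dilations (hg : DifferentiableOn ℂ g disk)
    (hφ : DifferentiableOn ℂ φ disk) (hφmaps : Set.MapsTo φ disk disk) {ν : RadialWeight}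
    (f : HInf ν) {u : ℕ → HInf ν} (hu : ∀ n, ∀ z ∈ disk, u n z = f ((rad n : ℂ) * z))
    {z : ℂ} (hz : z ∈ disk) :
    Tendsto (fun n => volterra g φ (u n) z) atTop (𝓝 (volterra g φ f z)) := by
  have hseg : ContinuousOn (fun t : ℝ => (t : ℂ) * z) (Set.Icc 0 1) := by fun_prop
  have hmaps : Set.MapsTo (fun t : ℝ => (t : ℂ) * z) (Set.Icc 0 1) disk :=
    fun t ht => ofReal_mul_mem_disk hz ht
  have hφd : ∀ t ∈ Set.Icc (0 : ℝ) 1, φ ((t : ℂ) * z) ∈ disk := fun t ht => hφmaps (hmaps ht)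
  have hsub : Set.uIoc (0 : ℝ) 1 ⊆ Set.Icc 0 1 := by
    rw [Set.uIoc_of_le zero_le_one]
    exact Set.Ioc_subset_Icc_self
  refine intervalIntegral.tendsto_integral_filter_of_dominated_convergence
    (fun t => ‖f‖ / ν (φ ((t : ℂ) * z)) * ‖deriv g ((t : ℂ) * z)‖ * ‖z‖) ?_ ?_ ?_ ?_
  · refine Eventually.of_forall fun n => ?_
    exact ((continuousOn_volterra_integrand hg hφ hφmaps
      (u n).differentiableOn.continuousOn hz).mono hsub).aestronglyMeasurable measurableSet_uIoc
  · refine Eventually.of_forall fun n => Eventually.of_forall fun t ht => ?_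
    have hw := hφd t (hsub ht)
    rw [norm_mul, norm_mul, hu n _ hw]
    refine mul_le_mul_of_nonneg_right (mul_le_mul_of_nonneg_right ?_ (norm_nonneg _))
      (norm_nonneg _)
    refine (f.norm_apply_le (rad_mul_mem_disk n hw)).trans ?_
    exact div_le_div_of_nonneg_left (norm_nonneg _) (ν.pos _ hw)
      (RadialWeight.le_of_norm_le hw (norm_rad_mul_le n _))
  · refine ContinuousOn.intervalIntegrable ?_
    rw [Set.uIcc_of_le zero_le_one]
    refine ContinuousOn.mul (ContinuousOn.mul (continuousOn_const.div
      ((ν.continuousOn.comp hφ.continuousOn hφmaps).comp hseg hmaps)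
      fun t ht => (ν.pos _ (hφd t ht)).ne') ?_) continuousOn_const
    exact ((hg.deriv Metric.isOpen_ball).continuousOn.comp hseg hmaps).norm
  · refine Eventually.of_forall fun t ht => ?_
    have hw := hφd t (hsub ht)
    have hc : ContinuousAt f (φ ((t : ℂ) * z)) :=
      f.differentiableOn.continuousOn.continuousAt (Metric.isOpen_ball.mem_nhds hw)
    have h1 : Tendsto (fun n => u n (φ ((t : ℂ) * z))) atTop (𝓝 (f (φ ((t : ℂ) * z)))) :=
      (hc.tendsto.comp (tendsto_rad_mul _)).congr fun n => (hu n _ hw).symm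
    exact (h1.mul_const _).mul_const _

theorem volterra_add (hg : DifferentiableOn ℂ g disk) (hφ : DifferentiableOn ℂ φ disk)
    (hφmaps : Set.MapsTo φ disk disk) {f₁ f₂ : ℂ → ℂ} (h₁ : ContinuousOn f₁ disk)
    (h₂ : ContinuousOn f₂ disk) {z : ℂ} (hz : z ∈ disk) :
    volterra g φ (f₁ + f₂) z = volterra g φ f₁ z + volterra g φ f₂ z := by
  rw [volterra, volterra, volterra, ← intervalIntegral.integral_add
    (intervalIntegrable_volterra_integrand hg hφ hφmaps h₁ hz)
    (intervalIntegrable_volterra_integrand hg hφ hφmaps h₂ hz)]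
  refine intervalIntegral.integral_congr fun t _ => ?_
  simp only [Pi.add_apply]
  ring

theorem volterra_smul (c : ℂ) (f : ℂ → ℂ) (z : ℂ) :
    volterra g φ (c • f) z = c * volterra g φ f z := by
  rw [volterra, volterra, ← intervalIntegral.integral_const_mul]
  refine intervalIntegral.integral_congr fun t _ => ?_
  simp only [Pi.smul_apply, smul_eq_mul]
  ring

namespace HZeroModel

variable {ν μ : RadialWeight} {X : Type} [NormedAddCommGroup X] [NormedSpace ℂ X]

/-- A bounded operator `T_g^φ : H^0_ν → H^∞_μ` extends to `T_g^φ : H^∞_ν → H^∞_μ`. -/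
theorem exists_volterra_extension (M : HZeroModel ν X) (hν : ν.IsNormal)
    (hg : DifferentiableOn ℂ g disk) (hφ : DifferentiableOn ℂ φ disk)
    (hφmaps : Set.MapsTo φ disk disk) (T : X →L[ℂ] HInf μ)
    (hT : ∀ f, ∀ z ∈ disk, T f z = volterra g φ (M.incl f) z) :
    ∃ S : HInf ν →L[ℂ] HInf μ, ∀ f, ∀ z ∈ disk, S f z = volterra g φ f z := by
  have hbound : ∀ f : HInf ν, ∀ z ∈ disk, μ z * ‖volterra g φ f z‖ ≤ ‖T‖ * ‖f‖ := by
    intro f z hz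
    obtain ⟨u, hu, huz⟩ := M.exists_dilations hν f
    refine le_of_tendsto
      ((tendsto_volterra_dilations hg hφ hφmaps f huz hz).norm.const_mul (μ z))
      (Eventually.of_forall fun n => ?_)
    rw [← hT (u n) z hz]
    exact ((T (u n)).weight_mul_le_norm hz).trans (T.le_opNorm_of_le (hu n))
  have hind : ∀ f : HInf ν, ∀ z ∈ disk, disk.indicator (volterra g φ f) z = volterra g φ f z :=
    fun f z hz => Set.indicator_of_mem hz _
  have hmem : ∀ f : HInf ν, disk.indicator (volterra g φ f) ∈ hInfSubmodule μ := by
    intro f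
    refine ⟨⟨(differentiableOn_volterra hg hφ hφmaps f.differentiableOn).congr (hind f),
      fun z hz => Set.indicator_of_notMem hz _⟩, ‖T‖ * ‖f‖, ?_⟩
    rintro _ ⟨z, rfl⟩
    simp only [hind f z z.2]
    exact hbound f z z.2
  let S₀ : HInf ν →ₗ[ℂ] HInf μ :=
    { toFun := fun f => ⟨_, hmem f⟩
      map_add' := fun f₁ f₂ => HInf.ext fun z hz => by
        show disk.indicator (volterra g φ (f₁ + f₂ : HInf ν)) z =
          disk.indicator (volterra g φ f₁) z + disk.indicator (volterra g φ f₂) z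
        rw [hind _ z hz, hind _ z hz, hind _ z hz]
        exact volterra_add hg hφ hφmaps f₁.differentiableOn.continuousOn
          f₂.differentiableOn.continuousOn hz
      map_smul' := fun c f => HInf.ext fun z hz => by
        show disk.indicator (volterra g φ (c • f : HInf ν)) z =
          c * disk.indicator (volterra g φ f) z
        rw [hind _ z hz, hind _ z hz]
        exact volterra_smul c f z }
  refine ⟨S₀.mkContinuous ‖T‖ fun f => HInf.norm_le fun z hz => ?_, fun f z hz => hind f z hz⟩
  show μ z * ‖disk.indicator (volterra g φ f) z‖ ≤ _
  rw [hind f z hz]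
  exact hbound f z hz

/-- Both sides are limits of `T (u n) z` along the dilations, one by weak-star convergence and one
by dominated convergence. -/
theorem apply_evalCLM_comp (M : HZeroModel ν X) (hν : ν.IsNormal)
    (hg : DifferentiableOn ℂ g disk) (hφ : DifferentiableOn ℂ φ disk)
    (hφmaps : Set.MapsTo φ disk disk) (T : X →L[ℂ] HInf μ)
    (hT : ∀ f, ∀ z ∈ disk, T f z = volterra g φ (M.incl f) z) (F : Bidual X)
    {z : ℂ} (hz : z ∈ disk) :
    F ((HInf.evalCLM μ z).comp T) = volterra g φ (M.bidualEquiv hν F) z := by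
  obtain ⟨u, hu, huz⟩ := M.exists_dilations hν (M.bidualEquiv hν F)
  refine tendsto_nhds_unique (M.tendsto_dilations hν F hu huz ((HInf.evalCLM μ z).comp T)) ?_
  exact (tendsto_volterra_dilations hg hφ hφmaps _ huz hz).congr fun n => (hT (u n) z hz).symm

end HZeroModel

end Volterra

end Extension

/-! ### The little Bloch condition and the two compactness criteria. -/

section LittleBloch

/-- The growth `(1 - a) ^ (-γ)` is exactly what the factor `(1 - a) ^ γ` from normality of the
weight absorbs in `tendsto_weight_mul_volterra`. -/
theorem integral_mul_one_sub_mul_rpow_le {a γ : ℝ} (ha0 : 0 ≤ a) (ha1 : a < 1) (hγ : 0 < γ) :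
    IntervalIntegrable (fun t : ℝ => a * (1 - t * a) ^ (-γ - 1)) MeasureTheory.volume 0 1 ∧
      ∫ t in (0 : ℝ)..1, a * (1 - t * a) ^ (-γ - 1) ≤ (1 - a) ^ (-γ) / γ := by
  have hpos : ∀ t ∈ Set.uIcc (0 : ℝ) 1, 0 < 1 - t * a := by
    intro t ht
    rw [Set.uIcc_of_le zero_le_one] at ht
    nlinarith [ht.1, ht.2]
  have hint : IntervalIntegrable (fun t : ℝ => a * (1 - t * a) ^ (-γ - 1))
      MeasureTheory.volume 0 1 := by
    refine ContinuousOn.intervalIntegrable (continuousOn_const.mul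
      (ContinuousOn.rpow_const (by fun_prop) fun t ht => Or.inl (hpos t ht).ne'))
  refine ⟨hint, ?_⟩
  have hderiv : ∀ t ∈ Set.uIcc (0 : ℝ) 1, HasDerivAt (fun t : ℝ => (1 - t * a) ^ (-γ) / γ)
      (a * (1 - t * a) ^ (-γ - 1)) t := by
    intro t ht
    have h1 : HasDerivAt (fun t : ℝ => 1 - t * a) (-a) t := by
      simpa using ((hasDerivAt_id t).mul_const a).const_sub 1
    have h2 := (h1.rpow_const (p := -γ) (Or.inl (hpos t ht).ne')).div_const γ
    have h3 : a * (1 - t * a) ^ (-γ - 1) = -a * -γ * (1 - t * a) ^ (-γ - 1) / γ := by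
      rw [eq_div_iff hγ.ne']
      ring
    rw [h3]
    exact h2
  rw [intervalIntegral.integral_eq_sub_of_hasDerivAt hderiv hint]
  simp only [one_mul, zero_mul, sub_zero, Real.one_rpow]
  have : 0 < 1 / γ := by positivity
  linarith

/-- If `g` belongs to the little Bloch space of the weight `(1 - |z|²) μ(z)` and `f` is bounded,
then `T_g^φ f` satisfies the growth condition of `H^0_μ`. -/
theorem tendsto_weight_mul_volterra {μ : RadialWeight} (hμ : μ.IsNormal) {g φ f : ℂ → ℂ}
    (hg : MemLittleBloch (fun z => (1 - ‖z‖ ^ 2) * μ z) g) (hφmaps : Set.MapsTo φ disk disk)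
    {K : ℝ} (hf : ∀ w ∈ disk, ‖f w‖ ≤ K) :
    Tendsto (fun z => μ z * ‖volterra g φ f z‖) toBoundary (𝓝 0) := by
  obtain ⟨γ, hγ, C, hC, hμC⟩ := hμ.exists_le_mul_rpow
  have hK : 0 ≤ K := (norm_nonneg _).trans (hf 0 (by simp))
  rw [tendsto_weight_mul_norm_iff]
  intro ε hε
  set D := K * C * 2 ^ γ / γ with hD
  have hD0 : 0 ≤ D := by positivity
  set δ := ε / 2 / (D + 1) with hδ
  have hδ0 : 0 < δ := by positivity
  have hDδ : D * δ < ε / 2 := by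
    rw [hδ, mul_div_assoc', div_lt_iff₀ (by positivity)]
    nlinarith
  obtain ⟨r, hr, hrw⟩ := eventually_toBoundary_iff.mp (hg.2.eventually (gt_mem_nhds hδ0))
  have hsub : Metric.closedBall (0 : ℂ) r ⊆ disk := Metric.closedBall_subset_ball hr
  obtain ⟨N, hN⟩ := (isCompact_closedBall (0 : ℂ) r).exists_bound_of_continuousOn
    ((hg.1.deriv Metric.isOpen_ball).continuousOn.mono hsub)
  -- The first term covers the compact disk of radius `r`, the second the rest.
  have hgbound : ∀ w ∈ disk, ‖deriv g w‖ ≤ |N| + δ / ((1 - ‖w‖ ^ 2) * μ w) := by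
    intro w hw
    have hw1 := mem_disk.mp hw
    have hpos : 0 < (1 - ‖w‖ ^ 2) * μ w :=
      mul_pos (by nlinarith [norm_nonneg w]) (μ.pos w hw)
    by_cases hwr : ‖w‖ ≤ r
    · have h1 := hN w (by simpa using hwr)
      have h2 : 0 ≤ δ / ((1 - ‖w‖ ^ 2) * μ w) := by positivity
      linarith [le_abs_self N]
    · have h1 := hrw w (not_le.mp hwr) hw1
      have h2 : ‖deriv g w‖ ≤ δ / ((1 - ‖w‖ ^ 2) * μ w) := by
        rw [le_div_iff₀' hpos]
        exact h1.le
      linarith [abs_nonneg N]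
  have hmain : ∀ z ∈ disk, μ z * ‖volterra g φ f z‖ ≤ K * |N| * μ z + D * δ := by
    intro z hz
    set a := ‖z‖ with ha
    have ha0 : 0 ≤ a := norm_nonneg z
    have ha1 : a < 1 := mem_disk.mp hz
    have hμz := μ.pos z hz
    obtain ⟨hint, hle⟩ := integral_mul_one_sub_mul_rpow_le ha0 ha1 hγ
    set Q := K * δ * C * (2 ^ γ * (1 - a) ^ γ) / μ z with hQ
    have h1a : 0 < 1 - a := by linarith
    have hQ0 : 0 ≤ Q := by positivity
    have hpt : ∀ t ∈ Set.Ioc (0 : ℝ) 1,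
        ‖f (φ ((t : ℂ) * z)) * deriv g ((t : ℂ) * z) * z‖ ≤
          K * |N| + Q * (a * (1 - t * a) ^ (-γ - 1)) := by
      intro t ht
      have htI : t ∈ Set.Icc (0 : ℝ) 1 := ⟨ht.1.le, ht.2⟩
      have hw := ofReal_mul_mem_disk hz htI
      set w := (t : ℂ) * z with hwdef
      have hwn : ‖w‖ = t * a := by
        rw [hwdef, norm_mul, Complex.norm_real, Real.norm_of_nonneg ht.1.le]
      have hw1 : t * a < 1 := by rw [← hwn]; exact mem_disk.mp hw
      have hta : 0 ≤ t * a := mul_nonneg ht.1.le ha0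
      have hta' : t * a ≤ a := mul_le_of_le_one_left ha0 ht.2
      have hb : 0 < 1 - t * a := by linarith
      have hbsq : 1 - t * a ≤ 1 - ‖w‖ ^ 2 := by rw [hwn]; nlinarith
      have hsq : 0 < 1 - ‖w‖ ^ 2 := hb.trans_le hbsq
      have hμw := μ.pos w hw
      have hcmp := hμC z hz w (by rw [hwn]; exact hta')
      -- Normality trades `μ w` for `μ z`; with `1 - a ^ 2 ≤ 2 * (1 - a)` and `1 - t * a ≤ 1 - ‖w‖ ^
      -- 2`, only an explicit power of `1 - t * a` depends on `t`.
      have hdec : 1 / ((1 - ‖w‖ ^ 2) * μ w) ≤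
          C * (2 ^ γ * (1 - a) ^ γ) / μ z * (1 - t * a) ^ (-γ - 1) := by
        have e1 : (1 - ‖z‖ ^ 2) ^ γ ≤ 2 ^ γ * (1 - a) ^ γ := by
          rw [← Real.mul_rpow (by norm_num) h1a.le]
          exact Real.rpow_le_rpow (by rw [← ha]; nlinarith) (by rw [← ha]; nlinarith) hγ.le
        have e2 : (1 - t * a) ^ γ ≤ (1 - ‖w‖ ^ 2) ^ γ := Real.rpow_le_rpow hb.le hbsq hγ.le
        have e3 : (1 - t * a) ^ (-γ - 1) = 1 / ((1 - t * a) ^ γ * (1 - t * a)) := by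
          rw [Real.rpow_sub hb, Real.rpow_neg hb.le, Real.rpow_one]
          field_simp
        have hbγ : 0 < (1 - t * a) ^ γ := Real.rpow_pos_of_pos hb _
        have hμz' : μ z ≤ C * μ w * (2 ^ γ * (1 - a) ^ γ / (1 - t * a) ^ γ) := by
          refine hcmp.trans (mul_le_mul_of_nonneg_left ?_ (by positivity))
          exact div_le_div₀ (by positivity) e1 hbγ e2
        rw [e3, div_mul_div_comm, div_le_div_iff₀ (by positivity) (by positivity), one_mul]
        rw [← mul_div_assoc, le_div_iff₀ hbγ] at hμz'
        calc μ z * ((1 - t * a) ^ γ * (1 - t * a))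
            = (μ z * (1 - t * a) ^ γ) * (1 - t * a) := by ring
          _ ≤ (C * μ w * (2 ^ γ * (1 - a) ^ γ)) * (1 - ‖w‖ ^ 2) :=
              mul_le_mul hμz' hbsq hb.le (by positivity)
          _ = C * (2 ^ γ * (1 - a) ^ γ) * 1 * ((1 - ‖w‖ ^ 2) * μ w) := by ring
      have hpow0 : 0 ≤ (1 - t * a) ^ (-γ - 1) := (Real.rpow_pos_of_pos hb _).le
      calc ‖f (φ w) * deriv g w * z‖ = ‖f (φ w)‖ * ‖deriv g w‖ * a := by
            rw [norm_mul, norm_mul]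
        _ ≤ K * (|N| + δ / ((1 - ‖w‖ ^ 2) * μ w)) * a := by
            refine mul_le_mul_of_nonneg_right ?_ ha0
            exact mul_le_mul (hf _ (hφmaps hw)) (hgbound w hw) (norm_nonneg _) hK
        _ = K * |N| * a + K * δ * (1 / ((1 - ‖w‖ ^ 2) * μ w)) * a := by ring
        _ ≤ K * |N| * 1 +
            K * δ * (C * (2 ^ γ * (1 - a) ^ γ) / μ z * (1 - t * a) ^ (-γ - 1)) * a := by
            refine add_le_add (mul_le_mul_of_nonneg_left ha1.le (by positivity)) ?_
            exact mul_le_mul_of_nonneg_right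
              (mul_le_mul_of_nonneg_left hdec (by positivity)) ha0
        _ = K * |N| + Q * (a * (1 - t * a) ^ (-γ - 1)) := by rw [hQ]; ring
    have hnorm : ‖volterra g φ f z‖ ≤ K * |N| + Q * ((1 - a) ^ (-γ) / γ) := by
      have hint2 : IntervalIntegrable (fun t : ℝ => K * |N| + Q * (a * (1 - t * a) ^ (-γ - 1)))
          MeasureTheory.volume 0 1 := intervalIntegrable_const.add (hint.const_mul Q)
      refine (intervalIntegral.norm_integral_le_of_norm_le zero_le_one
        (Eventually.of_forall hpt) hint2).trans ?_
      rw [intervalIntegral.integral_add intervalIntegrable_const (hint.const_mul Q),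
        intervalIntegral.integral_const, intervalIntegral.integral_const_mul]
      simp only [sub_zero, one_smul]
      exact add_le_add le_rfl (mul_le_mul_of_nonneg_left hle hQ0)
    calc μ z * ‖volterra g φ f z‖ ≤ μ z * (K * |N| + Q * ((1 - a) ^ (-γ) / γ)) :=
          mul_le_mul_of_nonneg_left hnorm hμz.le
      _ = K * |N| * μ z + D * δ := by
          have hp : 0 < (1 - a) ^ γ := Real.rpow_pos_of_pos h1a _
          rw [hQ, hD, Real.rpow_neg h1a.le]
          field_simp
  have hsmall : ∀ᶠ z in toBoundary, K * |N| * μ z < ε / 2 := by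
    have := hμ.tendsto_zero.const_mul (K * |N|)
    rw [mul_zero] at this
    exact this.eventually (gt_mem_nhds (half_pos hε))
  refine eventually_toBoundary_iff.mp ?_
  filter_upwards [hsmall, eventually_mem_disk] with z h1 h2
  linarith [hmain z h2]

theorem isClosed_hZero (ν : RadialWeight) : IsClosed (HZero ν : Set (HInf ν)) := by
  refine isClosed_of_closure_subset fun f hf => ?_
  refine tendsto_weight_mul_norm_iff.mpr fun ε hε => ?_
  obtain ⟨h, hh, hfh⟩ := Metric.mem_closure_iff.mp hf (ε / 2) (half_pos hε)
  obtain ⟨r, hr, hrz⟩ := tendsto_weight_mul_norm_iff.mp hh (ε / 2) (half_pos hε)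
  refine ⟨r, hr, fun z hz hz1 => ?_⟩
  have hzd := mem_disk.mpr hz1
  have h1 := (f - h).weight_mul_le_norm hzd
  rw [← dist_eq_norm, HInf.sub_apply] at h1
  have h2 := hrz z hz hz1
  have h3 := mul_le_mul_of_nonneg_left (norm_le_norm_add_norm_sub' (f z) (h z)) (ν.pos z hzd).le
  linarith

namespace HZeroModel

variable {ν μ : RadialWeight} {X Y : Type} [NormedAddCommGroup X] [NormedSpace ℂ X]
  [NormedAddCommGroup Y] [NormedSpace ℂ Y] {g φ : ℂ → ℂ}

theorem completeSpace (M : HZeroModel ν X) (hν : ν.IsNormal) : CompleteSpace X := by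
  have := M.completeSpace_hInf hν
  have hrange : Set.range M.incl = (HZero ν : Set (HInf ν)) := by
    ext f
    exact ⟨by rintro ⟨x, rfl⟩; exact M.incl_mem x, M.exists_incl_eq f⟩
  rw [completeSpace_iff_isComplete_range M.incl.isometry.isUniformInducing, hrange]
  exact (isClosed_hZero ν).isComplete

/-- The Bloch estimate needs a bounded function, so it is applied to dilations of `f`. They converge
weakly to `f`, and the closed subspace `HZero μ` is weakly closed. -/
theorem map_mem_hZero (M : HZeroModel ν X) (hν : ν.IsNormal) (hμ : μ.IsNormal)
    (hg : MemLittleBloch (fun z => (1 - ‖z‖ ^ 2) * μ z) g)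
    (hφmaps : Set.MapsTo φ disk disk) (T : X →L[ℂ] HInf μ)
    (hT : ∀ f, ∀ z ∈ disk, T f z = volterra g φ (M.incl f) z) (f : X) : T f ∈ HZero μ := by
  obtain ⟨u, hu, huz⟩ := M.exists_dilations hν (M.incl f)
  have hmem : ∀ n, T (u n) ∈ HZero μ := by
    intro n
    have hr : (rad n : ℂ) ∈ disk := mem_disk.mpr (by
      rw [Complex.norm_real, Real.norm_of_nonneg (rad_pos n).le]; exact rad_lt_one n)
    have h1 := tendsto_weight_mul_volterra hμ hg hφmaps (f := M.incl (u n))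
      (K := ‖M.incl f‖ / ν (rad n : ℂ)) (fun w hw => by
        rw [huz n w hw]
        refine ((M.incl f).norm_apply_le (rad_mul_mem_disk n hw)).trans ?_
        refine div_le_div_of_nonneg_left (norm_nonneg _) (ν.pos _ hr)
          (RadialWeight.le_of_norm_le hr ?_)
        rw [norm_mul]
        exact mul_le_of_le_one_right (norm_nonneg _) (mem_disk.mp hw).le)
    refine h1.congr' (eventually_mem_disk.mono fun z hz => ?_)
    simp only [hT (u n) z hz]
  refine mem_of_forall_dual_eq_zero (HZero μ) (isClosed_hZero μ) fun y' hy' => ?_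
  have h1 := M.tendsto_dilations hν (NormedSpace.inclusionInDoubleDual ℂ X f) hu huz (y'.comp T)
  refine tendsto_nhds_unique h1 (tendsto_const_nhds.congr fun n => ?_)
  exact (hy' _ (hmem n)).symm

theorem bidualEquiv_bitranspose (M : HZeroModel ν X) (M' : HZeroModel μ Y) (hν : ν.IsNormal)
    (hμ : μ.IsNormal) (hg : DifferentiableOn ℂ g disk) (hφ : DifferentiableOn ℂ φ disk)
    (hφmaps : Set.MapsTo φ disk disk) (T : X →L[ℂ] HInf μ)
    (hT : ∀ f, ∀ z ∈ disk, T f z = volterra g φ (M.incl f) z)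
    (S : HInf ν →L[ℂ] HInf μ) (hS : ∀ f, ∀ z ∈ disk, S f z = volterra g φ f z)
    (T₀ : X →L[ℂ] Y) (hT₀ : ∀ f, M'.incl (T₀ f) = T f) (F : Bidual X) :
    M'.bidualEquiv hμ (bitranspose T₀ F) = S (M.bidualEquiv hν F) := by
  refine HInf.ext fun z hz => ?_
  have h : (M'.eval z).comp T₀ = (HInf.evalCLM μ z).comp T := by
    ext f
    show M'.incl (T₀ f) z = T f z
    rw [hT₀]
  rw [bidualEquiv_apply, bitranspose_apply, h,
    M.apply_evalCLM_comp hν hg hφ hφmaps T hT F hz, hS _ z hz]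

/-- Under the identifications of the biduals, the right side says that the bi-transpose has range in
the canonical copy of `Y`. -/
theorem isCompactOperator_iff_forall_mem_hZero (M : HZeroModel ν X) (M' : HZeroModel μ Y)
    (hν : ν.IsNormal) (hμ : μ.IsNormal) (S : HInf ν →L[ℂ] HInf μ) (T₀ : X →L[ℂ] Y)
    (hS : ∀ F, M'.bidualEquiv hμ (bitranspose T₀ F) = S (M.bidualEquiv hν F)) :
    IsCompactOperator T₀ ↔ ∀ f, S f ∈ HZero μ := by
  constructor
  · intro hc f
    obtain ⟨F, rfl⟩ := (M.bidualEquiv hν).surjective f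
    obtain ⟨y, hy⟩ := M.exists_bitranspose_eq hν T₀ (isWeaklyCompactOp_of_isCompactOperator hc) F
    rw [← hS, hy, bidualEquiv_inclusion]
    exact M'.incl_mem y
  · intro hall
    have := M'.completeSpace hμ
    refine M.isCompactOperator_of_bitranspose T₀ fun F => ?_
    obtain ⟨y, hy⟩ := M'.exists_incl_eq _ (hall (M.bidualEquiv hν F))
    refine ⟨y, (M'.bidualEquiv hμ).injective ?_⟩
    rw [hS, bidualEquiv_inclusion, hy]

theorem tfae_compact (M : HZeroModel ν X) (hν : ν.IsNormal) (hc : CompleteSpace (HInf μ))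
    (hg : DifferentiableOn ℂ g disk) (hφ : DifferentiableOn ℂ φ disk)
    (hφmaps : Set.MapsTo φ disk disk) (T : X →L[ℂ] HInf μ)
    (hT : ∀ f, ∀ z ∈ disk, T f z = volterra g φ (M.incl f) z)
    (S : HInf ν →L[ℂ] HInf μ) (hS : ∀ f, ∀ z ∈ disk, S f z = volterra g φ f z) :
    [IsCompactOperator T, IsWeaklyCompactOp T, ∀ F : Bidual X, bitranspose T F =
      NormedSpace.inclusionInDoubleDual ℂ (HInf μ) (S (M.bidualEquiv hν F))].TFAE := by
  tfae_have 1 → 2 := isWeaklyCompactOp_of_isCompactOperator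
  tfae_have 2 → 3 := by
    intro hw F
    -- Weak compactness yields some `y`; testing against point evaluations identifies it.
    obtain ⟨y, hy⟩ := M.exists_bitranspose_eq hν T hw F
    rw [hy]
    congr 1
    refine HInf.ext fun z hz => ?_
    have h1 : bitranspose T F (HInf.evalCLM μ z) = y z := by rw [hy]; rfl
    rw [← h1, bitranspose_apply, M.apply_evalCLM_comp hν hg hφ hφmaps T hT F hz, hS _ z hz]
  tfae_have 3 → 1 := fun h => M.isCompactOperator_of_bitranspose T fun F => ⟨_, h F⟩
  tfae_finish

end HZeroModel

/-- The identity model of `H^0_ν`. -/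
def hZeroModel (ν : RadialWeight) : HZeroModel ν (HZero ν) where
  incl := (HZero ν).subtypeₗᵢ
  incl_mem f := f.2
  exists_incl_eq f hf := ⟨⟨f, hf⟩, rfl⟩

end LittleBloch

end VolterraComp

end

theorem mainTheorem7 (ν μ : VolterraComp.RadialWeight) (hν : ν.IsNormal) (hμ : μ.IsNormal)
    (g φ : ℂ → ℂ) (hg : DifferentiableOn ℂ g VolterraComp.disk)
    (hφ : DifferentiableOn ℂ φ VolterraComp.disk)
    (hφmaps : Set.MapsTo φ VolterraComp.disk VolterraComp.disk)
    -- `T` is the bounded operator `T_g^φ : H^0_ν → H^∞_μ`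
    (T : VolterraComp.HZero ν →L[ℂ] VolterraComp.HInf μ)
    (hT : ∀ f : VolterraComp.HZero ν, ∀ z ∈ VolterraComp.disk,
      T f z = VolterraComp.volterra g φ (f : VolterraComp.HInf ν) z) :
    -- the canonical identifications of the biduals, and `T_g^φ : H^∞_ν → H^∞_μ`
    ∃ (Φν : VolterraComp.Bidual (VolterraComp.HZero ν) ≃L[ℂ] VolterraComp.HInf ν)
      (Φμ : VolterraComp.Bidual (VolterraComp.HZero μ) ≃L[ℂ] VolterraComp.HInf μ)
      (S : VolterraComp.HInf ν →L[ℂ] VolterraComp.HInf μ),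
      VolterraComp.IsCanonical ν Φν ∧ VolterraComp.IsCanonical μ Φμ ∧
      (∀ f : VolterraComp.HInf ν, ∀ z ∈ VolterraComp.disk,
        S f z = VolterraComp.volterra g φ f z) ∧
      [IsCompactOperator T,
        VolterraComp.IsWeaklyCompactOp T,
        ∀ F : VolterraComp.Bidual (VolterraComp.HZero ν),
          VolterraComp.bitranspose T F =
            NormedSpace.inclusionInDoubleDual ℂ (VolterraComp.HInf μ) (S (Φν F))].TFAE ∧
      (VolterraComp.MemLittleBloch (fun z => (1 - ‖z‖ ^ 2) * μ z) g →
        ∃ T₀ : VolterraComp.HZero ν →L[ℂ] VolterraComp.HZero μ,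
          (∀ f : VolterraComp.HZero ν, ∀ z ∈ VolterraComp.disk,
            (T₀ f : VolterraComp.HInf μ) z =
              VolterraComp.volterra g φ (f : VolterraComp.HInf ν) z) ∧
          (∀ F : VolterraComp.Bidual (VolterraComp.HZero ν),
            Φμ (VolterraComp.bitranspose T₀ F) = S (Φν F)) ∧
          (IsCompactOperator T₀ ↔
            ∀ f : VolterraComp.HInf ν, S f ∈ VolterraComp.HZero μ)) := by
  obtain ⟨S, hS⟩ := (VolterraComp.hZeroModel ν).exists_volterra_extension hν hg hφ hφmaps T hT
  have hc := (VolterraComp.hZeroModel μ).completeSpace_hInf hμ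
  refine ⟨(VolterraComp.hZeroModel ν).bidualEquiv hν, (VolterraComp.hZeroModel μ).bidualEquiv hμ,
    S, fun F z _ => rfl, fun F z _ => rfl, hS,
    (VolterraComp.hZeroModel ν).tfae_compact hν hc hg hφ hφmaps T hT S hS, fun hb => ?_⟩
  have hmem := (VolterraComp.hZeroModel ν).map_mem_hZero hν hμ hb hφmaps T hT
  have hF := (VolterraComp.hZeroModel ν).bidualEquiv_bitranspose (VolterraComp.hZeroModel μ)
    hν hμ hg hφ hφmaps T hT S hS (T.codRestrict (VolterraComp.HZero μ) hmem) fun _ => rfl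
  exact ⟨T.codRestrict (VolterraComp.HZero μ) hmem, hT, hF,
    (VolterraComp.hZeroModel ν).isCompactOperator_iff_forall_mem_hZero
      (VolterraComp.hZeroModel μ) hν hμ S _ hF⟩
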